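/- Let $\varphi:\mathbb R^n\to\mathbb R$ be a strictly convex function of class $C^2$ such that $\lim_{|x|\to\infty}\varphi(x)/|x|=+\infty$ and $\int_{\mathbb R^n}e^{-\varphi(x)}\,dx=1$, and let $\mu_\varphi$ be the probability measure $\mu_\varphi(dx)=e^{-\varphi(x)}\,dx$ on $\mathbb R^n$. Then for every $g:\mathbb R^n\to\mathbb R$ of class $C^1$ that is integrable with respect to $\mu_\varphi$, $$ \mathrm{Var}_{\mu_\varphi}(g):=\int\Big(g-\int g\,d\mu_\varphi\Big)^2d\mu_\varphi\;\le\;\int \nabla g\cdot \mathrm{Hess}(\varphi)^{-1}\nabla g\,d\mu_\varphi , $$ where both sides are integrals of nonnegative functions with values in $[0,\infty]$; in particular, if the right-hand side is finite, then $g\in L^2(\mu_\varphi)$. Here $\mathrm{Hess}(\varphi)^{-1}$ is the inverse of the Hessian of $\varphi$. At points $x$ where $H=\mathrm{Hess}(\varphi)(x)$ is singular, the usual convention is used: $v\cdot H^{-1}v:=v\cdot w$ for any $w$ with $Hw=v$ if $v$ lies in the range of $H$ (the value does not depend on $w$), and $v\cdot H^{-1}v:=+\infty$ otherwise. -/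

import Mathlib

open MeasureTheory Filter
open scoped ENNReal

/-- The measure `e^{-φ(x)} dx` on `ℝⁿ`. -/
noncomputable def gibbsMeasure {n : ℕ} (φ : EuclideanSpace ℝ (Fin n) → ℝ) :
    Measure (EuclideanSpace ℝ (Fin n)) :=
  volume.withDensity (fun x => ENNReal.ofReal (Real.exp (-φ x)))

/-- The Hessian of `φ` at `x`, as the linear map `v ↦ D(∇φ)(x) v` of `ℝⁿ`. -/
noncomputable def hessian {n : ℕ} (φ : EuclideanSpace ℝ (Fin n) → ℝ)
    (x : EuclideanSpace ℝ (Fin n)) :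
    EuclideanSpace ℝ (Fin n) →L[ℝ] EuclideanSpace ℝ (Fin n) :=
  fderiv ℝ (gradient φ) x

open Classical in
/-- The value `v · A⁻¹ v ∈ [0, ∞]` for a symmetric positive semidefinite `A`. If `A` is
invertible this is literally `v · A⁻¹ v` (a nonnegative number). If `A` is singular, the usual
convention is used: the value is `v · w` for any solution `w` of `A w = v` (it does not depend on
`w`, since `A` is symmetric), and `∞` if `v` is not in the range of `A` (infimum over the empty
set). -/
noncomputable def invQuadForm {n : ℕ}
    (A : EuclideanSpace ℝ (Fin n) →L[ℝ] EuclideanSpace ℝ (Fin n))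
    (v : EuclideanSpace ℝ (Fin n)) : ℝ≥0∞ :=
  if A.IsInvertible then ENNReal.ofReal (inner ℝ v (A.inverse v))
  else ⨅ (w : EuclideanSpace ℝ (Fin n)) (_ : A w = v), ENNReal.ofReal (inner ℝ v w)

/-! ### The Prékopa–Leindler inequality for midpoints -/

/-! The inequality is the second order term of a midpoint Prékopa–Leindler inequality. Suppose `q`
dominates `2⟨∇g, w⟩ - ⟨Hess φ w, w⟩` for all `w`; the least such `q` is `∇g · Hess(φ)⁻¹ ∇g` when the
Hessian is positive definite. By Taylor expansion, for small `t`, the value of `t g - t²/2 (q + δ)`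
at `x` is at most `t g(z)` plus the Bregman distance `φ x - φ z - ⟨∇φ z, x - z⟩`
(`exists_forall_le_add_bregman`). Take `z` to be the midpoint of `x` and `y`, and add the bounds for
`t` at `x` and `-t` at `y`: the terms in `g z` and `∇φ z` cancel, leaving the hypothesis of
`prekopa_leindler`. Hence `∫ exp(t g - t²/2 (q + δ)) dμ · ∫ exp(-t g - t²/2 (q + δ)) dμ ≤ μ(ℝⁿ)²`,
and the coefficient of `t²` gives the variance bound.

The Taylor step needs uniformity: `g` compactly supported and `Hess φ ≥ ε`. Cutoffs extend the bound
to bounded `g`; adding `ε|x|²/2` to `φ` and letting `ε → 0` removes the lower bound on the Hessian;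
truncating `g` and applying Fatou's lemma gives the general case. The perturbed measures are not
normalised, so the intermediate inequalities carry the total mass explicitly. -/

theorem volume_add_volume_le_of_isCompact {K L C : Set ℝ} (hK : IsCompact K) (hL : IsCompact L)
    (hK' : K.Nonempty) (hL' : L.Nonempty) (h : ∀ a ∈ K, ∀ b ∈ L, (a + b) / 2 ∈ C) :
    volume K + volume L ≤ 2 * volume C := by
  -- With `a = max K` and `b = min L`, the translates `K + b` and `L + a` both lie in `2C` and meet
  -- at most in the point `a + b`.
  obtain ⟨a, haK, ha⟩ := hK.exists_isGreatest hK'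
  obtain ⟨b, hbL, hb⟩ := hL.exists_isLeast hL'
  have hD : volume ((fun c : ℝ => 2⁻¹ * c) ⁻¹' C) = 2 * volume C := by
    rw [Real.volume_preimage_mul_left (by norm_num)]
    norm_num
  have h1 : volume ((fun c : ℝ => c + -b) ⁻¹' K) = volume K := measure_preimage_add_right _ _ _
  have h2 : volume ((fun c : ℝ => c + -a) ⁻¹' L) = volume L := measure_preimage_add_right _ _ _
  have hL2 : MeasurableSet ((fun c : ℝ => c + -a) ⁻¹' L) :=
    hL.measurableSet.preimage (by fun_prop)
  rw [← hD, ← h1, ← h2, ← measure_union₀ hL2.nullMeasurableSet]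
  · refine measure_mono ?_
    rintro c (hc | hc)
    · have := h _ hc _ hbL
      simp only [Set.mem_preimage] at *
      convert this using 1
      ring
    · have := h _ haK _ hc
      simp only [Set.mem_preimage] at *
      convert this using 1
      ring
  · refine measure_mono_null (t := {a + b}) ?_ (by simp)
    rintro c ⟨hc1, hc2⟩
    have := ha hc1
    have := hb hc2
    simp only [Set.mem_singleton_iff]
    linarith

theorem MeasurableSet.volume_eq_iSup_subtype_isCompact {A : Set ℝ} (hA : MeasurableSet A) :
    volume A = ⨆ K : {K : Set ℝ // K ⊆ A ∧ IsCompact K}, volume K.1 := by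
  rw [hA.measure_eq_iSup_isCompact, iSup_subtype]
  simp only [iSup_and]

/-- The one-dimensional Brunn–Minkowski inequality. -/
theorem volume_add_volume_le_of_midpoint_mem {A B C : Set ℝ} (hA : MeasurableSet A)
    (hB : MeasurableSet B) (hA' : A.Nonempty) (hB' : B.Nonempty)
    (h : ∀ a ∈ A, ∀ b ∈ B, (a + b) / 2 ∈ C) :
    volume A + volume B ≤ 2 * volume C := by
  obtain ⟨a, ha⟩ := hA'
  obtain ⟨b, hb⟩ := hB'
  rw [hA.volume_eq_iSup_subtype_isCompact, hB.volume_eq_iSup_subtype_isCompact]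
  have (S : Set ℝ) : Nonempty {K : Set ℝ // K ⊆ S ∧ IsCompact K} :=
    ⟨⟨∅, Set.empty_subset _, isCompact_empty⟩⟩
  refine ENNReal.iSup_add_iSup_le ?_
  rintro ⟨K, hKA, hK⟩ ⟨L, hLB, hL⟩
  -- The inner compact approximants may be empty, so a point of each set is adjoined.
  refine (add_le_add (measure_mono (Set.subset_insert a K))
    (measure_mono (Set.subset_insert b L))).trans ?_
  refine volume_add_volume_le_of_isCompact (hK.insert a) (hL.insert b) (Set.insert_nonempty _ _)
    (Set.insert_nonempty _ _) fun x hx y hy => h _ ?_ _ ?_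
  · exact Set.insert_subset ha hKA hx
  · exact Set.insert_subset hb hLB hy

/-- Layer-cake formula. Excluding the level `1` matters later: for a function with supremum `1`,
superlevel sets are guaranteed nonempty only below it. -/
theorem lintegral_eq_setLIntegral_meas_lt_of_le_one {f : ℝ → ℝ≥0∞} (hf : Measurable f)
    (hf1 : ∀ x, f x ≤ 1) :
    ∫⁻ x, f x = ∫⁻ t in Set.Ioo (0 : ℝ) 1, volume {x | ENNReal.ofReal t < f x} := by
  have hfin : ∀ x, f x ≠ ∞ := fun x => ((hf1 x).trans_lt ENNReal.one_lt_top).ne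
  have h0 : ∫⁻ x, f x = ∫⁻ x, ENNReal.ofReal (f x).toReal := by
    simp_rw [ENNReal.ofReal_toReal (hfin _)]
  rw [h0, lintegral_eq_lintegral_meas_lt volume (ae_of_all _ fun x => ENNReal.toReal_nonneg)
    hf.ennreal_toReal.aemeasurable]
  rw [← setLIntegral_congr (Ioo_ae_eq_Ioc (a := (0 : ℝ)) (b := 1)).symm,
    ← Set.Ioc_union_Ioi_eq_Ioi (zero_le_one' ℝ),
    lintegral_union measurableSet_Ioi Set.Ioc_disjoint_Ioi_same]
  have h2 : ∫⁻ t in Set.Ioi (1 : ℝ), volume {x | t < (f x).toReal} = 0 := by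
    rw [setLIntegral_congr_fun (g := fun _ => 0) measurableSet_Ioi]
    · simp
    · intro t ht
      have : {x | t < (f x).toReal} = ∅ := by
        ext x
        simp only [Set.mem_ofPred_eq, Set.mem_empty_iff_false, iff_false, not_lt]
        refine le_trans ?_ (le_of_lt ht)
        exact ENNReal.toReal_le_of_le_ofReal zero_le_one (by simpa using hf1 x)
      simp [this]
  rw [h2, add_zero]
  refine setLIntegral_congr_fun measurableSet_Ioc fun t ht => ?_
  have : {x | t < (f x).toReal} = {x | ENNReal.ofReal t < f x} := by
    ext x
    exact (ENNReal.ofReal_lt_iff_lt_toReal ht.1.le (hfin x)).symm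
  simp [this]

theorem ENNReal.mul_le_sq_of_add_le_two_mul {a b c : ℝ≥0∞} (h : a + b ≤ 2 * c) : a * b ≤ c ^ 2 := by
  rcases eq_or_ne c ∞ with rfl | hc
  · simp
  have hab : a + b ≠ ∞ := (h.trans_lt (ENNReal.mul_lt_top (by simp) hc.lt_top)).ne
  rw [ENNReal.add_ne_top] at hab
  lift a to NNReal using hab.1
  lift b to NNReal using hab.2
  lift c to NNReal using hc
  norm_cast at *
  have h' : (a : ℝ) + b ≤ 2 * c := by exact_mod_cast h
  have : (a : ℝ) * b ≤ c ^ 2 := by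
    have := a.2; have := b.2; have := c.2
    nlinarith [sq_nonneg ((a : ℝ) - b), mul_self_le_mul_self (by positivity) h']
  exact_mod_cast this

/-- Midpoints of `{f > t}` and `{g > t}` lie in `{min h 1 > t}` for `t < 1`, so the one-dimensional
Brunn–Minkowski inequality can be integrated over the levels. The suprema of `f` and `g` must both
be `1`, so that these sets are nonempty for the same `t`. -/
theorem lintegral_add_lintegral_le_of_le_one {f g h : ℝ → ℝ≥0∞} (hf : Measurable f)
    (hg : Measurable g) (hh : Measurable h) (hf1 : ∀ x, f x ≤ 1) (hg1 : ∀ x, g x ≤ 1)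
    (hf2 : ∀ t < 1, ∃ x, t < f x) (hg2 : ∀ t < 1, ∃ x, t < g x)
    (H : ∀ x y, f x * g y ≤ h ((x + y) / 2) ^ 2) :
    (∫⁻ x, f x) + ∫⁻ x, g x ≤ 2 * ∫⁻ x, h x := by
  have hle : ∫⁻ x, min (h x) 1 ≤ ∫⁻ x, h x := lintegral_mono fun x => min_le_left _ _
  refine le_trans ?_ (mul_le_mul_right hle 2)
  have hanti : ∀ u : ℝ → ℝ≥0∞, Antitone fun t : ℝ => volume {x | ENNReal.ofReal t < u x} :=
    fun u s t hst => measure_mono fun x hx => (ENNReal.ofReal_le_ofReal hst).trans_lt hx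
  rw [lintegral_eq_setLIntegral_meas_lt_of_le_one hf hf1,
    lintegral_eq_setLIntegral_meas_lt_of_le_one hg hg1,
    lintegral_eq_setLIntegral_meas_lt_of_le_one (hh.min measurable_const)
      (fun x => min_le_right _ _),
    ← lintegral_add_left (hanti f).measurable, ← lintegral_const_mul _ (hanti _).measurable]
  refine setLIntegral_mono ((hanti _).measurable.const_mul 2) fun t ht => ?_
  have ht1 : ENNReal.ofReal t < 1 := by simpa using ht.2
  refine volume_add_volume_le_of_midpoint_mem (measurableSet_lt measurable_const hf)
    (measurableSet_lt measurable_const hg) (hf2 _ ht1) (hg2 _ ht1) fun x hx y hy => ?_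
  refine lt_min ?_ ht1
  by_contra hcon
  rw [not_lt] at hcon
  have h1 := (ENNReal.mul_lt_mul hx hy).trans_le (H x y)
  rw [← sq] at h1
  exact absurd h1 (not_lt.2 (pow_le_pow_left' hcon 2))

/-- Dividing `f`, `g`, `h` by `a = sup f`, `b = sup g` and `√(ab)` reduces to suprema equal to `1`;
AM–GM then turns the additive bound into the multiplicative one. -/
theorem lintegral_mul_lintegral_le_of_le_const {f g h : ℝ → ℝ≥0∞} (hf : Measurable f)
    (hg : Measurable g) (hh : Measurable h) {k l : ℝ≥0∞} (hk : k ≠ ∞) (hl : l ≠ ∞)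
    (hfk : ∀ x, f x ≤ k) (hgl : ∀ x, g x ≤ l)
    (H : ∀ x y, f x * g y ≤ h ((x + y) / 2) ^ 2) :
    (∫⁻ x, f x) * ∫⁻ x, g x ≤ (∫⁻ x, h x) ^ 2 := by
  set a := ⨆ x, f x with ha
  set b := ⨆ x, g x with hb
  have ha_top : a ≠ ∞ := ((iSup_le hfk).trans_lt hk.lt_top).ne
  have hb_top : b ≠ ∞ := ((iSup_le hgl).trans_lt hl.lt_top).ne
  rcases eq_or_ne a 0 with ha0 | ha0
  · have : ∀ x, f x = 0 := by simpa [ha] using ha0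
    simp [this]
  rcases eq_or_ne b 0 with hb0 | hb0
  · have : ∀ x, g x = 0 := by simpa [hb] using hb0
    simp [this]
  obtain ⟨c, hc⟩ : ∃ c : ℝ≥0∞, c ^ 2 = a * b := by
    refine ⟨(a * b) ^ (2⁻¹ : ℝ), ?_⟩
    rw [← ENNReal.rpow_natCast, ← ENNReal.rpow_mul]
    simp
  have hc0 : c ≠ 0 := by
    rintro rfl
    simp [ha0, hb0] at hc
  have hc_top : c ≠ ∞ := by
    rintro rfl
    exact (ENNReal.mul_ne_top ha_top hb_top) (by simpa using hc.symm)
  have hsup : ∀ (u : ℝ → ℝ≥0∞) (s : ℝ≥0∞), s = ⨆ x, u x → s ≠ 0 → s ≠ ∞ →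
      ∀ t < 1, ∃ x, t < s⁻¹ * u x := by
    intro u s hs hs0 hst t ht
    have : t * s < ⨆ x, u x := by
      rw [← hs]
      simpa using ENNReal.mul_lt_mul_left hs0 hst ht
    obtain ⟨x, hx⟩ := lt_iSup_iff.1 this
    refine ⟨x, ?_⟩
    rw [mul_comm, ← div_eq_mul_inv]
    exact (ENNReal.lt_div_iff_mul_lt (Or.inl hs0) (Or.inl hst)).2 hx
  have hle : ∀ (u : ℝ → ℝ≥0∞) (s : ℝ≥0∞), s = ⨆ x, u x → s ≠ 0 → s ≠ ∞ →
      ∀ x, s⁻¹ * u x ≤ 1 := by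
    intro u s hs hs0 hst x
    rw [← ENNReal.inv_mul_cancel hs0 hst]
    gcongr
    rw [hs]
    exact le_iSup u x
  have key := lintegral_add_lintegral_le_of_le_one (hf.const_mul a⁻¹) (hg.const_mul b⁻¹)
    (hh.const_mul c⁻¹) (hle f a ha ha0 ha_top) (hle g b hb hb0 hb_top)
    (hsup f a ha ha0 ha_top) (hsup g b hb hb0 hb_top) (fun x y => by
      rw [mul_pow, ← ENNReal.inv_pow, hc,
        ENNReal.mul_inv (Or.inl ha0) (Or.inl ha_top), mul_mul_mul_comm]
      gcongr
      exact H x y)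
  rw [lintegral_const_mul _ hf, lintegral_const_mul _ hg, lintegral_const_mul _ hh] at key
  have h2 := ENNReal.mul_le_sq_of_add_le_two_mul key
  have hX : ∀ (s : ℝ≥0∞) (X : ℝ≥0∞), s ≠ 0 → s ≠ ∞ → s * (s⁻¹ * X) = X := fun s X h0 ht => by
    rw [← mul_assoc, ENNReal.mul_inv_cancel h0 ht, one_mul]
  calc (∫⁻ x, f x) * ∫⁻ x, g x
      = (a * b) * ((a⁻¹ * ∫⁻ x, f x) * (b⁻¹ * ∫⁻ x, g x)) := by
        rw [mul_mul_mul_comm, hX a _ ha0 ha_top, hX b _ hb0 hb_top]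
    _ ≤ c ^ 2 * (c⁻¹ * ∫⁻ x, h x) ^ 2 := by
        rw [hc]
        gcongr
    _ = (∫⁻ x, h x) ^ 2 := by rw [← mul_pow, hX c _ hc0 hc_top]

theorem lintegral_eq_iSup_lintegral_min_natCast {f : ℝ → ℝ≥0∞} (hf : Measurable f) :
    ∫⁻ x, f x = ⨆ k : ℕ, ∫⁻ x, min (f x) k := by
  rw [← lintegral_iSup (fun k => hf.min measurable_const)
    (fun k l hkl x => min_le_min le_rfl (by exact_mod_cast hkl))]
  refine lintegral_congr fun x => ?_
  rw [← inf_iSup_eq, ENNReal.iSup_natCast, inf_top_eq]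

/-- The Prékopa–Leindler inequality on the line. -/
theorem prekopa_leindler_real {f g h : ℝ → ℝ≥0∞} (hf : Measurable f)
    (hg : Measurable g) (hh : Measurable h) (H : ∀ x y, f x * g y ≤ h ((x + y) / 2) ^ 2) :
    (∫⁻ x, f x) * ∫⁻ x, g x ≤ (∫⁻ x, h x) ^ 2 := by
  rw [lintegral_eq_iSup_lintegral_min_natCast hf, lintegral_eq_iSup_lintegral_min_natCast hg,
    ENNReal.iSup_mul]
  refine iSup_le fun k => ?_
  rw [ENNReal.mul_iSup]
  refine iSup_le fun l => ?_
  exact lintegral_mul_lintegral_le_of_le_const (hf.min measurable_const) (hg.min measurable_const)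
    hh (ENNReal.natCast_ne_top k) (ENNReal.natCast_ne_top l) (fun x => min_le_right _ _)
    (fun x => min_le_right _ _)
    (fun x y => (mul_le_mul' (min_le_left _ _) (min_le_left _ _)).trans (H x y))

theorem lintegral_pi_succ {n : ℕ} {f : (Fin (n + 1) → ℝ) → ℝ≥0∞} (hf : Measurable f) :
    ∫⁻ x, f x = ∫⁻ s : ℝ, ∫⁻ v : Fin n → ℝ, f (Fin.cons s v) := by
  have e := (volume_preserving_piFinSuccAbove (fun _ : Fin (n + 1) => ℝ) 0).symm
  rw [← e.lintegral_comp hf, Measure.volume_eq_prod, lintegral_prod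
    (fun p => f ((MeasurableEquiv.piFinSuccAbove (fun _ : Fin (n + 1) => ℝ) 0).symm p))
    (hf.comp e.measurable).aemeasurable]
  simp [MeasurableEquiv.piFinSuccAbove, Fin.consEquiv]

theorem measurable_fin_cons {n : ℕ} :
    Measurable fun p : ℝ × (Fin n → ℝ) => (Fin.cons p.1 p.2 : Fin (n + 1) → ℝ) := by
  refine measurable_pi_iff.2 fun i => ?_
  refine Fin.cases ?_ (fun j => ?_) i
  · simpa using measurable_fst
  · simpa using! (measurable_pi_apply j).comp measurable_snd

/-- Tensorisation: the slices of `f`, `g`, `h` at first coordinates `s`, `t`, `(s + t) / 2` satisfy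
the hypothesis in one dimension less, so the marginals satisfy the hypothesis on the line. -/
theorem prekopa_leindler_pi (n : ℕ) {f g h : (Fin n → ℝ) → ℝ≥0∞} (hf : Measurable f)
    (hg : Measurable g) (hh : Measurable h)
    (H : ∀ x y, f x * g y ≤ h (fun i => (x i + y i) / 2) ^ 2) :
    (∫⁻ x, f x) * ∫⁻ x, g x ≤ (∫⁻ x, h x) ^ 2 := by
  induction n with
  | zero =>
    have := H 0 0
    have hu : ∀ u : (Fin 0 → ℝ) → ℝ≥0∞, ∫⁻ x, u x = u 0 := fun u => by
      have h1 : volume (Set.univ : Set (Fin 0 → ℝ)) = 1 := by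
        rw [volume_pi, Measure.pi_univ]
        simp
      rw [lintegral_unique, h1, mul_one]
      exact congrArg u (Subsingleton.elim _ _)
    rw [hu, hu, hu]
    convert this using 3
  | succ n ih =>
    rw [lintegral_pi_succ hf, lintegral_pi_succ hg, lintegral_pi_succ hh]
    refine prekopa_leindler_real (hf.comp measurable_fin_cons).lintegral_prod_right'
      (hg.comp measurable_fin_cons).lintegral_prod_right'
      (hh.comp measurable_fin_cons).lintegral_prod_right' fun s t => ?_
    refine ih (hf.comp (measurable_fin_cons.comp measurable_prodMk_left))
      (hg.comp (measurable_fin_cons.comp measurable_prodMk_left))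
      (hh.comp (measurable_fin_cons.comp measurable_prodMk_left)) fun x y => ?_
    refine (H _ _).trans (le_of_eq ?_)
    congr 2
    ext i
    refine Fin.cases ?_ (fun j => ?_) i <;> simp

/-- The Prékopa–Leindler inequality in `ℝⁿ`. -/
theorem prekopa_leindler {n : ℕ} {f g h : EuclideanSpace ℝ (Fin n) → ℝ≥0∞} (hf : Measurable f)
    (hg : Measurable g) (hh : Measurable h)
    (H : ∀ x y, f x * g y ≤ h ((2⁻¹ : ℝ) • (x + y)) ^ 2) :
    (∫⁻ x, f x) * ∫⁻ x, g x ≤ (∫⁻ x, h x) ^ 2 := by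
  have e := PiLp.volume_preserving_toLp (Fin n)
  rw [← e.lintegral_comp hf, ← e.lintegral_comp hg, ← e.lintegral_comp hh]
  refine prekopa_leindler_pi n (hf.comp e.measurable) (hg.comp e.measurable)
    (hh.comp e.measurable) fun x y => (H _ _).trans (le_of_eq ?_)
  congr 2
  ext i
  simp
  ring

/-! ### Gradient, Hessian and Taylor estimates -/

section Calculus

variable {n : ℕ} {φ g : EuclideanSpace ℝ (Fin n) → ℝ}

theorem gradient_eq_toDual_symm_comp_fderiv :
    gradient φ = fun x => (InnerProductSpace.toDual ℝ (EuclideanSpace ℝ (Fin n))).symm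
      (fderiv ℝ φ x) := rfl

theorem ContDiff.gradient_one (hφ : ContDiff ℝ 2 φ) : ContDiff ℝ 1 (gradient φ) := by
  have h : ContDiff ℝ 1 (fderiv ℝ φ) := hφ.fderiv_right (by norm_num)
  rw [gradient_eq_toDual_symm_comp_fderiv]
  exact (InnerProductSpace.toDual ℝ (EuclideanSpace ℝ (Fin n))).symm.contDiff.comp h

theorem ContDiff.continuous_gradient (hg : ContDiff ℝ 1 g) : Continuous (gradient g) := by
  rw [gradient_eq_toDual_symm_comp_fderiv]
  exact (InnerProductSpace.toDual ℝ (EuclideanSpace ℝ (Fin n))).symm.continuous.comp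
    (hg.continuous_fderiv (by norm_num))

theorem ContDiff.hasFDerivAt_gradient (hφ : ContDiff ℝ 2 φ) (x : EuclideanSpace ℝ (Fin n)) :
    HasFDerivAt (gradient φ) (hessian φ x) x :=
  (hφ.gradient_one.differentiable (by norm_num) x).hasFDerivAt

theorem ContDiff.continuous_hessian (hφ : ContDiff ℝ 2 φ) : Continuous (hessian φ) :=
  hφ.gradient_one.continuous_fderiv (by norm_num)

theorem ContDiff.inner_hessian_comm (hφ : ContDiff ℝ 2 φ) (x v w : EuclideanSpace ℝ (Fin n)) :
    Inner.inner ℝ (hessian φ x v) w = Inner.inner ℝ v (hessian φ x w) := by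
  have h : ∀ a b, Inner.inner ℝ (hessian φ x a) b = fderiv ℝ (fderiv ℝ φ) x a b := by
    intro a b
    have h1 : HasFDerivAt (fun y => Inner.inner ℝ (gradient φ y) b)
        ((fderivInnerCLM ℝ (gradient φ x, b)).comp ((hessian φ x).prod 0)) x :=
      (hφ.hasFDerivAt_gradient x).inner ℝ (hasFDerivAt_const b x)
    have h2 : HasFDerivAt (fun y => fderiv ℝ φ y b)
        ((ContinuousLinearMap.apply ℝ ℝ b).comp (fderiv ℝ (fderiv ℝ φ) x)) x :=
      (ContinuousLinearMap.apply ℝ ℝ b).hasFDerivAt.comp x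
        (((hφ.fderiv_right (m := 1) (by norm_num)).differentiable (by norm_num)) x).hasFDerivAt
    simp only [inner_gradient_left] at h1
    simpa [fderivInnerCLM_apply] using DFunLike.congr_fun (h1.unique h2) a
  rw [h, real_inner_comm, h]
  exact (hφ.contDiffAt.isSymmSndFDerivAt (by simp)) v w

theorem ContDiff.hasDerivAt_line (hg : ContDiff ℝ 1 g) (x v : EuclideanSpace ℝ (Fin n)) (s : ℝ) :
    HasDerivAt (fun s : ℝ => g (x + s • v)) (Inner.inner ℝ (gradient g (x + s • v)) v) s := by
  rw [inner_gradient_left]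
  have h1 : HasDerivAt (fun s : ℝ => x + s • v) v s := by
    simpa using ((hasDerivAt_id s).smul_const v).const_add x
  exact (hg.differentiable (by norm_num) (x + s • v)).hasFDerivAt.comp_hasDerivAt s h1

theorem ContDiff.hasDerivAt_inner_gradient_line (hφ : ContDiff ℝ 2 φ)
    (x v : EuclideanSpace ℝ (Fin n)) (s : ℝ) :
    HasDerivAt (fun s : ℝ => Inner.inner ℝ (gradient φ (x + s • v)) v)
      (Inner.inner ℝ (hessian φ (x + s • v) v) v) s := by
  have h1 : HasDerivAt (fun s : ℝ => x + s • v) v s := by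
    simpa using ((hasDerivAt_id s).smul_const v).const_add x
  simpa using ((hφ.hasFDerivAt_gradient (x + s • v)).comp_hasDerivAt s h1).inner ℝ
    (hasDerivAt_const s v)

theorem ConvexOn.inner_hessian_nonneg (hφ : ContDiff ℝ 2 φ) (hc : ConvexOn ℝ Set.univ φ)
    (x v : EuclideanSpace ℝ (Fin n)) : 0 ≤ Inner.inner ℝ (hessian φ x v) v := by
  have hd := (hφ.of_le one_le_two).hasDerivAt_line x v
  have hline : ConvexOn ℝ Set.univ (fun s : ℝ => φ (x + s • v)) := by
    refine ⟨convex_univ, fun a _ b _ p r hp hr hpr => ?_⟩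
    have := hc.2 (Set.mem_univ (x + a • v)) (Set.mem_univ (x + b • v)) hp hr hpr
    convert this using 2
    obtain rfl : r = 1 - p := by linarith
    simp only [smul_eq_mul]
    module
  have hmono : Monotone (deriv fun s : ℝ => φ (x + s • v)) :=
    monotoneOn_univ.1 (hline.monotoneOn_deriv fun s _ => (hd s).differentiableAt)
  have heq : (deriv fun s : ℝ => φ (x + s • v)) = fun s => Inner.inner ℝ (gradient φ (x + s • v)) v :=
    funext fun s => (hd s).deriv
  have := hmono.deriv_nonneg (x := 0)
  rw [heq, (hφ.hasDerivAt_inner_gradient_line x v 0).deriv] at this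
  simpa using this

/-- Second order Taylor lower bound along a segment. -/
theorem ContDiff.add_half_le_of_le_inner_hessian (hφ : ContDiff ℝ 2 φ)
    (x v : EuclideanSpace ℝ (Fin n)) {c : ℝ}
    (hc : ∀ s ∈ Set.Icc (0 : ℝ) 1, c ≤ Inner.inner ℝ (hessian φ (x + s • v) v) v) :
    φ x + Inner.inner ℝ (gradient φ x) v + c / 2 ≤ φ (x + v) := by
  have hd1 : ∀ s : ℝ, HasDerivAt (fun s : ℝ => Inner.inner ℝ (gradient φ (x + s • v)) v - c * s)
      (Inner.inner ℝ (hessian φ (x + s • v) v) v - c) s := fun s => by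
    simpa using! (hφ.hasDerivAt_inner_gradient_line x v s).sub ((hasDerivAt_id s).const_mul c)
  have hd0 : ∀ s : ℝ, HasDerivAt
      (fun s : ℝ => φ (x + s • v) - (Inner.inner ℝ (gradient φ x) v * s + c / 2 * s ^ 2))
      (Inner.inner ℝ (gradient φ (x + s • v)) v - c * s - Inner.inner ℝ (gradient φ x) v) s := fun s => by
    have h1 := ((hφ.of_le one_le_two).hasDerivAt_line x v s).sub
      (((hasDerivAt_id s).const_mul (Inner.inner ℝ (gradient φ x) v)).add
        (((hasDerivAt_id s).pow 2).const_mul (c / 2)))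
    refine (h1.congr_deriv ?_)
    simp
    ring
  have hm1 : MonotoneOn (fun s : ℝ => Inner.inner ℝ (gradient φ (x + s • v)) v - c * s)
      (Set.Icc 0 1) := by
    refine monotoneOn_of_deriv_nonneg (convex_Icc 0 1)
      (fun s _ => (hd1 s).continuousAt.continuousWithinAt)
      (fun s _ => (hd1 s).differentiableAt.differentiableWithinAt) fun s hs => ?_
    rw [(hd1 s).deriv]
    linarith [hc s (interior_subset hs)]
  have hm0 : MonotoneOn
      (fun s : ℝ => φ (x + s • v) - (Inner.inner ℝ (gradient φ x) v * s + c / 2 * s ^ 2))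
      (Set.Icc 0 1) := by
    refine monotoneOn_of_deriv_nonneg (convex_Icc 0 1)
      (fun s _ => (hd0 s).continuousAt.continuousWithinAt)
      (fun s _ => (hd0 s).differentiableAt.differentiableWithinAt) fun s hs => ?_
    rw [(hd0 s).deriv]
    have hs' := interior_subset hs
    have := hm1 (Set.left_mem_Icc.2 zero_le_one) hs' hs'.1
    simp only [zero_smul, add_zero, mul_zero, sub_zero] at this
    linarith
  have := hm0 (Set.left_mem_Icc.2 zero_le_one) (Set.right_mem_Icc.2 zero_le_one) zero_le_one
  simp only [zero_smul, add_zero, mul_zero, one_smul, mul_one, one_pow] at this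
  linarith

theorem norm_gradient (x : EuclideanSpace ℝ (Fin n)) : ‖gradient g x‖ = ‖fderiv ℝ g x‖ := by
  rw [gradient_eq_toDual_symm_comp_fderiv]
  simp

theorem ContDiff.exists_norm_gradient_le (hg : ContDiff ℝ 1 g) (hgs : HasCompactSupport g) :
    ∃ L > 0, ∀ x, ‖gradient g x‖ ≤ L := by
  obtain ⟨L, hL⟩ := (hgs.fderiv (𝕜 := ℝ)).exists_bound_of_continuous
    (hg.continuous_fderiv (by norm_num))
  refine ⟨max L 1, by positivity, fun x => ?_⟩
  rw [norm_gradient]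
  exact (hL x).trans (le_max_left _ _)

theorem ContDiff.abs_sub_le_of_norm_gradient_le (hg : ContDiff ℝ 1 g) {L : ℝ}
    (hL : ∀ x, ‖gradient g x‖ ≤ L) (x z : EuclideanSpace ℝ (Fin n)) :
    |g x - g z| ≤ L * ‖x - z‖ := by
  have := convex_univ.norm_image_sub_le_of_norm_fderiv_le (𝕜 := ℝ) (f := g) (C := L)
    (fun x _ => hg.differentiable (by norm_num) x) (fun x _ => by rw [← norm_gradient]; exact hL x)
    (Set.mem_univ z) (Set.mem_univ x)
  simpa using this

/-- First order Taylor estimate on a ball where the gradient oscillates by at most `η`. -/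
theorem ContDiff.sub_le_of_norm_gradient_sub_le (hg : ContDiff ℝ 1 g) {η ρ : ℝ}
    {x v : EuclideanSpace ℝ (Fin n)} (hv : ‖v‖ < ρ)
    (h : ∀ y, ‖y - x‖ < ρ → ‖gradient g y - gradient g x‖ ≤ η) :
    |g (x + v) - g x - Inner.inner ℝ (gradient g x) v| ≤ η * ‖v‖ := by
  have hρ : 0 < ρ := (norm_nonneg v).trans_lt hv
  have := (convex_ball x ρ).norm_image_sub_le_of_norm_fderiv_le' (𝕜 := ℝ) (f := g) (C := η)
    (φ := fderiv ℝ g x) (fun y _ => hg.differentiable (by norm_num) y) (fun y hy => by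
      have h1 := h y (by simpa [dist_eq_norm] using hy)
      simp only [gradient_eq_toDual_symm_comp_fderiv] at h1
      rwa [← map_sub, LinearIsometryEquiv.norm_map] at h1)
    (Metric.mem_ball_self hρ) (show x + v ∈ Metric.ball x ρ by simpa using hv)
  simpa [inner_gradient_left] using this

end Calculus

/-! ### The uniform second order estimate -/

section Estimate

variable {n : ℕ} {φ g q : EuclideanSpace ℝ (Fin n) → ℝ}

/-- With `v = z - x`, right minus left is, to second order, `t⟨∇g x, v⟩ + ⟨Hess φ(x) v, v⟩/2 + t²/2
(q x + δ)`, and `hq` makes this nonnegative. For `z` far from `x` coercivity beats the Lipschitz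
bound on `g`; for `z` near `x` the Taylor errors are uniformly small by compactness and are absorbed
by `δ`. -/
theorem exists_forall_le_add_bregman (hφ : ContDiff ℝ 2 φ) {ε : ℝ} (hε : 0 < ε)
    (hH : ∀ x v, ε * ‖v‖ ^ 2 ≤ inner ℝ (hessian φ x v) v)
    (hg : ContDiff ℝ 1 g) (hgs : HasCompactSupport g) (hq0 : ∀ x, 0 ≤ q x)
    (hq : ∀ x w, 2 * inner ℝ (gradient g x) w - inner ℝ (hessian φ x w) w ≤ q x)
    {δ : ℝ} (hδ : 0 < δ) :
    ∃ τ > 0, ∀ t : ℝ, |t| ≤ τ → ∀ x z, t * g x - t ^ 2 / 2 * (q x + δ) ≤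
      t * g z + (φ x - φ z - inner ℝ (gradient φ z) (x - z)) := by
  obtain ⟨L, hL0, hL⟩ := hg.exists_norm_gradient_le hgs
  obtain ⟨R, hR⟩ := hgs.isBounded.subset_closedBall 0
  -- Threshold beyond which `L |t| r ≤ ε/2 r²`, namely `r ≥ C |t|`.
  set C := 2 * L / ε with hC
  have hC0 : 0 < C := by positivity
  -- For `‖v‖ ≤ C |t|`, the first order error of `g` and the second order error of `φ` total at most
  -- `η (C + C²/2) t²`.
  obtain ⟨η, hη0, hη⟩ : ∃ η > 0, η * (C + C ^ 2 / 2) = δ / 2 :=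
    ⟨δ / 2 / (C + C ^ 2 / 2), by positivity, by field_simp⟩
  have hHu := (isCompact_closedBall (0 : EuclideanSpace ℝ (Fin n))
    (R + 2)).uniformContinuousOn_of_continuous hφ.continuous_hessian.continuousOn
  have hGu := (isCompact_closedBall (0 : EuclideanSpace ℝ (Fin n))
    (R + 2)).uniformContinuousOn_of_continuous hg.continuous_gradient.continuousOn
  obtain ⟨ρ₁, hρ₁, h1⟩ := Metric.uniformContinuousOn_iff.1 hHu η hη0
  obtain ⟨ρ₂, hρ₂, h2⟩ := Metric.uniformContinuousOn_iff.1 hGu η hη0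
  set ρ := min (min ρ₁ ρ₂) 1 with hρ
  have hρ0 : 0 < ρ := by positivity
  refine ⟨ρ / (2 * C), by positivity, fun t ht x z => ?_⟩
  have hCt : C * |t| < ρ := by
    calc C * |t| ≤ C * (ρ / (2 * C)) := by gcongr
      _ = ρ / 2 := by field_simp
      _ < ρ := by linarith
  have hD : ε / 2 * ‖x - z‖ ^ 2 ≤ φ x - φ z - inner ℝ (gradient φ z) (x - z) := by
    have := hφ.add_half_le_of_le_inner_hessian z (x - z) (c := ε * ‖x - z‖ ^ 2)
      (fun s _ => hH _ _)
    rw [add_sub_cancel] at this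
    linarith
  have hD0 : 0 ≤ φ x - φ z - inner ℝ (gradient φ z) (x - z) := le_trans (by positivity) hD
  have hqδ : 0 ≤ t ^ 2 / 2 * (q x + δ) := by have := hq0 x; positivity
  rcases lt_or_ge (C * |t|) ‖x - z‖ with hfar | hnear
  · have h3 : t * (g x - g z) ≤ |t| * (L * ‖x - z‖) := by
      refine (le_abs_self _).trans ?_
      rw [abs_mul]
      gcongr
      exact hg.abs_sub_le_of_norm_gradient_le hL x z
    have h4 : |t| * (L * ‖x - z‖) ≤ ε / 2 * ‖x - z‖ ^ 2 := by
      have : L * |t| = ε / 2 * (C * |t|) := by rw [hC]; field_simp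
      calc |t| * (L * ‖x - z‖) = ε / 2 * (C * |t|) * ‖x - z‖ := by rw [← this]; ring
        _ ≤ ε / 2 * ‖x - z‖ * ‖x - z‖ := by gcongr
        _ = ε / 2 * ‖x - z‖ ^ 2 := by ring
    nlinarith
  -- Here `z` is within distance `1` of `x`, so for `‖x‖ > R + 1` both points lie outside the
  -- support of `g`.
  rcases lt_or_ge (R + 1) ‖x‖ with hxR | hxR
  · have hg0 : ∀ y : EuclideanSpace ℝ (Fin n), R < ‖y‖ → g y = 0 := fun y hy => by
      by_contra h
      have := hR (subset_tsupport g h)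
      rw [mem_closedBall_zero_iff] at this
      linarith
    have hz : R < ‖z‖ := by
      have := norm_le_norm_add_norm_sub z x
      have : ρ ≤ 1 := min_le_right _ _
      have := norm_sub_rev x z
      linarith
    rw [hg0 x (by linarith), hg0 z hz]
    linarith
  set v := z - x with hv
  have hvn : ‖x - z‖ = ‖v‖ := norm_sub_rev x z
  rw [hvn] at hnear
  have hxK : x ∈ Metric.closedBall (0 : EuclideanSpace ℝ (Fin n)) (R + 2) := by
    rw [mem_closedBall_zero_iff]; linarith
  have hK : ∀ y, dist y x < ρ → y ∈ Metric.closedBall (0 : EuclideanSpace ℝ (Fin n)) (R + 2) := by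
    intro y hy
    rw [mem_closedBall_zero_iff]
    have := norm_le_norm_add_norm_sub x y
    have : ρ ≤ 1 := min_le_right _ _
    rw [dist_eq_norm, norm_sub_rev] at hy
    linarith
  have hvρ : ‖v‖ < ρ := hnear.trans_lt hCt
  have hgx := hg.sub_le_of_norm_gradient_sub_le (η := η) hvρ fun y hy => by
    rw [← dist_eq_norm] at hy ⊢
    exact (h2 y (hK y hy) x hxK (hy.trans_le ((min_le_left _ _).trans (min_le_right _ _)))).le
  have hDx : (inner ℝ (hessian φ x v) v - η * ‖v‖ ^ 2) / 2 ≤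
      φ x - φ z - inner ℝ (gradient φ z) (x - z) := by
    have := hφ.add_half_le_of_le_inner_hessian z (x - z)
      (c := inner ℝ (hessian φ x v) v - η * ‖v‖ ^ 2) (fun s hs => ?_)
    · rw [add_sub_cancel] at this
      linarith
    · set p := z + s • (x - z) with hp
      have hpx : p - x = (1 - s) • v := by
        rw [hp, hv]
        module
      have hpd : dist p x < ρ := by
        rw [dist_eq_norm, hpx, norm_smul, Real.norm_of_nonneg (by linarith [hs.2])]
        refine lt_of_le_of_lt ?_ hvρ
        exact mul_le_of_le_one_left (norm_nonneg v) (by linarith [hs.1])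
      have h5 : ‖hessian φ p - hessian φ x‖ ≤ η := by
        rw [← dist_eq_norm]
        exact (h1 p (hK p hpd) x hxK
          (hpd.trans_le ((min_le_left _ _).trans (min_le_left _ _)))).le
      have h6 : |inner ℝ ((hessian φ p - hessian φ x) v) v| ≤ η * ‖v‖ ^ 2 := by
        calc |inner ℝ ((hessian φ p - hessian φ x) v) v|
            ≤ ‖(hessian φ p - hessian φ x) v‖ * ‖v‖ := abs_real_inner_le_norm _ _
          _ ≤ η * ‖v‖ * ‖v‖ := by
            gcongr
            exact (ContinuousLinearMap.le_opNorm _ _).trans (by gcongr)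
          _ = η * ‖v‖ ^ 2 := by ring
      rw [show x - z = -v by rw [hv]; abel, map_neg, inner_neg_neg]
      rw [sub_apply, inner_sub_left] at h6
      linarith [(abs_le.1 h6).1]
  rw [show x + v = z by rw [hv]; abel] at hgx
  rcases eq_or_ne t 0 with rfl | ht0
  · simpa using hD0
  have hqx : -t * inner ℝ (gradient g x) v - inner ℝ (hessian φ x v) v / 2 ≤ t ^ 2 / 2 * q x := by
    -- The test vector `-v/t` makes the dual bound, scaled by `t²/2`, match the Taylor polynomial.
    have h7 := hq x ((-t⁻¹) • v)
    rw [map_smul, inner_smul_left, inner_smul_right, inner_smul_right] at h7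
    simp only [conj_trivial] at h7
    have h8 := mul_le_mul_of_nonneg_left h7 (show 0 ≤ t ^ 2 / 2 by positivity)
    refine le_trans (le_of_eq ?_) h8
    field_simp
  have hlin : t * (g x - g z) ≤ -t * inner ℝ (gradient g x) v + |t| * (η * ‖v‖) := by
    have : t * (g x - g z) + t * inner ℝ (gradient g x) v =
        -t * (g z - g x - inner ℝ (gradient g x) v) := by ring
    have h9 : -t * (g z - g x - inner ℝ (gradient g x) v) ≤ |t| * (η * ‖v‖) := by
      refine (le_abs_self _).trans ?_
      rw [abs_mul, abs_neg]
      gcongr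
    linarith
  have herr : |t| * (η * ‖v‖) + η * ‖v‖ ^ 2 / 2 ≤ t ^ 2 / 2 * δ := by
    calc |t| * (η * ‖v‖) + η * ‖v‖ ^ 2 / 2
        ≤ |t| * (η * (C * |t|)) + η * (C * |t|) ^ 2 / 2 := by gcongr
      _ = η * (C + C ^ 2 / 2) * |t| ^ 2 := by ring
      _ = t ^ 2 / 2 * δ := by rw [hη, sq_abs]; ring
  linarith

end Estimate

/-! ### The variance inequality under a uniform lower bound on the Hessian -/

section Gibbs

variable {n : ℕ} {φ g q : EuclideanSpace ℝ (Fin n) → ℝ}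

theorem lintegral_gibbsMeasure (hφ : Continuous φ) (f : EuclideanSpace ℝ (Fin n) → ℝ≥0∞) :
    ∫⁻ x, f x ∂(gibbsMeasure φ) = ∫⁻ x, ENNReal.ofReal (Real.exp (-φ x)) * f x := by
  rw [gibbsMeasure, lintegral_withDensity_eq_lintegral_mul_non_measurable]
  · rfl
  · exact (Real.measurable_exp.comp hφ.measurable.neg).ennreal_ofReal
  · exact ae_of_all _ fun x => ENNReal.ofReal_lt_top

theorem integral_gibbsMeasure (hφ : Continuous φ) (f : EuclideanSpace ℝ (Fin n) → ℝ) :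
    ∫ x, f x ∂(gibbsMeasure φ) = ∫ x, Real.exp (-φ x) * f x := by
  rw [gibbsMeasure, integral_withDensity_eq_integral_toReal_smul]
  · simp [ENNReal.toReal_ofReal (Real.exp_nonneg _)]
  · exact (Real.measurable_exp.comp hφ.measurable.neg).ennreal_ofReal
  · exact ae_of_all _ fun x => ENNReal.ofReal_lt_top

theorem isFiniteMeasure_gibbsMeasure (hint : Integrable fun x => Real.exp (-φ x)) :
    IsFiniteMeasure (gibbsMeasure φ) :=
  isFiniteMeasure_withDensity_ofReal hint.2

theorem integral_exp_mul_integral_exp_le_of_midpoint (hφ : Continuous φ)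
    (hint : Integrable fun x => Real.exp (-φ x)) {a b : EuclideanSpace ℝ (Fin n) → ℝ}
    (ha : Measurable a) (hb : Measurable b)
    (H : ∀ x y, a x - φ x + (b y - φ y) ≤ 2 * -φ ((2⁻¹ : ℝ) • (x + y))) :
    (∫ x, Real.exp (a x) ∂(gibbsMeasure φ)) * ∫ x, Real.exp (b x) ∂(gibbsMeasure φ) ≤
      (gibbsMeasure φ).real Set.univ ^ 2 := by
  have := isFiniteMeasure_gibbsMeasure hint
  have hlint : ∀ u : EuclideanSpace ℝ (Fin n) → ℝ,
      ∫⁻ x, ENNReal.ofReal (Real.exp (u x)) ∂(gibbsMeasure φ) =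
        ∫⁻ x, ENNReal.ofReal (Real.exp (u x - φ x)) := fun u => by
    rw [lintegral_gibbsMeasure hφ]
    refine lintegral_congr fun x => ?_
    rw [← ENNReal.ofReal_mul (Real.exp_nonneg _), ← Real.exp_add]
    ring_nf
  have huniv : gibbsMeasure φ Set.univ = ∫⁻ x, ENNReal.ofReal (Real.exp (-φ x)) := by
    simpa using hlint 0
  have hm : ∀ u : EuclideanSpace ℝ (Fin n) → ℝ, Measurable u →
      Measurable fun x => ENNReal.ofReal (Real.exp (u x)) := fun u hu =>
    (Real.measurable_exp.comp hu).ennreal_ofReal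
  have key := prekopa_leindler (hm _ (ha.sub hφ.measurable)) (hm _ (hb.sub hφ.measurable))
    (hm _ hφ.measurable.neg) fun x y => by
      rw [← ENNReal.ofReal_mul (Real.exp_nonneg _), ← Real.exp_add,
        ← ENNReal.ofReal_pow (Real.exp_nonneg _), ← Real.exp_nat_mul]
      exact ENNReal.ofReal_le_ofReal (Real.exp_le_exp.2 (by simpa using H x y))
  simp only [Pi.sub_apply, Pi.neg_apply] at key
  rw [← hlint, ← hlint, ← huniv] at key
  have hreal : ∀ u : EuclideanSpace ℝ (Fin n) → ℝ, Measurable u →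
      ∫ x, Real.exp (u x) ∂(gibbsMeasure φ) =
        (∫⁻ x, ENNReal.ofReal (Real.exp (u x)) ∂(gibbsMeasure φ)).toReal := fun u hu =>
    integral_eq_lintegral_of_nonneg_ae (ae_of_all _ fun x => Real.exp_nonneg _)
      (Real.measurable_exp.comp hu).aestronglyMeasurable
  rw [hreal a ha, hreal b hb, ← ENNReal.toReal_mul, Measure.real, ← ENNReal.toReal_pow]
  exact ENNReal.toReal_mono (ENNReal.pow_ne_top (measure_ne_top _ _)) key

end Gibbs

/-! ### Second order expansion of the exponential inequality -/

theorem Real.one_add_add_sq_sub_le_exp {u c : ℝ} (hu : |u| ≤ c) (hc : c ≤ 1) :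
    1 + u + u ^ 2 / 2 - c ^ 3 ≤ Real.exp u := by
  have h := Real.exp_bound (hu.trans hc) (n := 3) (by norm_num)
  simp only [Finset.sum_range_succ, Finset.sum_range_zero] at h
  norm_num [Nat.factorial] at h
  have h1 := (abs_le.1 h).1
  have h2 : |u| ^ 3 ≤ c ^ 3 := by gcongr
  have h3 : 0 ≤ |u| ^ 3 := by positivity
  nlinarith

/-- Here `p` has no upper bound, so `exp(-t² p/2)` is only bounded below by `1 - t² p/2`: the
estimate is linear in `p`, and integrability of `p` suffices to integrate it. -/
theorem Real.one_add_add_sq_sub_le_exp_sub {s t g p M : ℝ} (hst : |s| = t) (hg : |g| ≤ M)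
    (htM : t * M ≤ 1) (hp : 0 ≤ p) :
    1 + s * g + s ^ 2 / 2 * g ^ 2 - (t * M) ^ 3 - t ^ 2 / 2 * Real.exp (t * M) * p ≤
      Real.exp (s * g - t ^ 2 / 2 * p) := by
  have ht : 0 ≤ t := hst ▸ abs_nonneg s
  have hsg : |s * g| ≤ t * M := by rw [abs_mul, hst]; gcongr
  have h1 := Real.one_add_add_sq_sub_le_exp hsg htM
  have h2 : Real.exp (s * g) ≤ Real.exp (t * M) := Real.exp_le_exp.2 ((le_abs_self _).trans hsg)
  have h3 : 1 - t ^ 2 / 2 * p ≤ Real.exp (-(t ^ 2 / 2 * p)) := by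
    linarith [Real.add_one_le_exp (-(t ^ 2 / 2 * p))]
  have h4 : Real.exp (s * g) * (1 - t ^ 2 / 2 * p) ≤ Real.exp (s * g - t ^ 2 / 2 * p) := by
    rw [sub_eq_add_neg (s * g), Real.exp_add]
    gcongr
  have h5 : Real.exp (s * g) * (t ^ 2 / 2 * p) ≤ Real.exp (t * M) * (t ^ 2 / 2 * p) := by gcongr
  nlinarith

theorem mul_integral_sq_le_of_integral_exp_mul_integral_exp_le {α : Type*} [MeasurableSpace α]
    {ν : Measure α} [IsFiniteMeasure ν] {g p : α → ℝ} {M τ : ℝ} (hg : Measurable g)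
    (hgM : ∀ x, |g x| ≤ M) (hp : Measurable p) (hp0 : ∀ x, 0 ≤ p x) (hpi : Integrable p ν)
    (hτ : 0 < τ)
    (h : ∀ t, 0 < t → t ≤ τ → (∫ x, Real.exp (t * g x - t ^ 2 / 2 * p x) ∂ν) *
      ∫ x, Real.exp (-t * g x - t ^ 2 / 2 * p x) ∂ν ≤ ν.real Set.univ ^ 2) :
    ν.real Set.univ * ∫ x, g x ^ 2 ∂ν ≤
      (∫ x, g x ∂ν) ^ 2 + ν.real Set.univ * ∫ x, p x ∂ν := by
  set Z := ν.real Set.univ with hZ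
  set G := ∫ x, g x ∂ν with hG
  set G2 := ∫ x, g x ^ 2 ∂ν with hG2
  set P := ∫ x, p x ∂ν with hP
  rcases (measureReal_nonneg : 0 ≤ ν.real Set.univ).eq_or_lt with hZ0 | hZ0
  · rw [hZ, ← hZ0]
    nlinarith [sq_nonneg G]
  have hgi : Integrable g ν := Integrable.of_bound hg.aestronglyMeasurable M (ae_of_all _ hgM)
  have hg2i : Integrable (fun x => g x ^ 2) ν :=
    Integrable.of_bound (hg.pow_const 2).aestronglyMeasurable (M ^ 2) (ae_of_all _ fun x => by
      rw [Real.norm_of_nonneg (sq_nonneg _), ← sq_abs]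
      have := hgM x
      gcongr)
  have hlow : ∀ s t : ℝ, |s| = t → t * M ≤ 1 →
      Z + s * G + s ^ 2 / 2 * G2 - (t * M) ^ 3 * Z - t ^ 2 / 2 * Real.exp (t * M) * P ≤
        ∫ x, Real.exp (s * g x - t ^ 2 / 2 * p x) ∂ν := by
    intro s t hst htM
    have i0 : Integrable (fun _ : α => (1 : ℝ)) ν := integrable_const _
    have i1 := hgi.const_mul s
    have i2 := hg2i.const_mul (s ^ 2 / 2)
    have i3 : Integrable (fun _ : α => (t * M) ^ 3) ν := integrable_const _
    have i4 := hpi.const_mul (t ^ 2 / 2 * Real.exp (t * M))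
    have i01 : Integrable (fun x => 1 + s * g x) ν := i0.add i1
    have i012 : Integrable (fun x => 1 + s * g x + s ^ 2 / 2 * g x ^ 2) ν := i01.add i2
    have i0123 : Integrable (fun x => 1 + s * g x + s ^ 2 / 2 * g x ^ 2 - (t * M) ^ 3) ν :=
      i012.sub i3
    have e : ∫ x, (1 + s * g x + s ^ 2 / 2 * g x ^ 2 - (t * M) ^ 3
        - t ^ 2 / 2 * Real.exp (t * M) * p x) ∂ν =
        Z + s * G + s ^ 2 / 2 * G2 - (t * M) ^ 3 * Z - t ^ 2 / 2 * Real.exp (t * M) * P := by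
      rw [integral_sub i0123 i4, integral_sub i012 i3, integral_add i01 i2,
        integral_add i0 i1, integral_const_mul, integral_const_mul,
        integral_const_mul, integral_const, integral_const]
      simp only [smul_eq_mul, mul_one]
      ring
    rw [← e]
    refine integral_mono (i0123.sub i4) ?_ fun x =>
      Real.one_add_add_sq_sub_le_exp_sub hst (hgM x) htM (hp0 x)
    refine Integrable.of_bound (by fun_prop) (Real.exp (t * M)) (ae_of_all _ fun x => ?_)
    rw [Real.norm_of_nonneg (Real.exp_nonneg _)]
    refine Real.exp_le_exp.2 ?_
    have h1 : s * g x ≤ t * M := by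
      refine (le_abs_self _).trans ?_
      rw [abs_mul, hst]
      have := hgM x
      have : 0 ≤ t := hst ▸ abs_nonneg s
      gcongr
    have := hp0 x
    have : 0 ≤ t ^ 2 / 2 * p x := by positivity
    linarith
  have hev : ∀ᶠ t : ℝ in nhdsWithin 0 (Set.Ioi 0),
      Z * (G2 - Real.exp (t * M) * P) - 2 * M ^ 3 * Z ^ 2 * t ≤ G ^ 2 := by
    have e1 : ∀ᶠ t : ℝ in nhdsWithin 0 (Set.Ioi 0), t * M < 1 :=
      (((by fun_prop : Continuous fun t : ℝ => t * M).tendsto' 0 0 (by simp)).mono_left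
        nhdsWithin_le_nhds).eventually_lt_const zero_lt_one
    have hpos : ∀ σ : ℝ, ∀ᶠ t : ℝ in nhdsWithin 0 (Set.Ioi 0),
        0 < Z + σ * t * G + t ^ 2 / 2 * G2 - (t * M) ^ 3 * Z -
          t ^ 2 / 2 * Real.exp (t * M) * P := fun σ =>
      (((by fun_prop : Continuous fun t : ℝ => Z + σ * t * G + t ^ 2 / 2 * G2 - (t * M) ^ 3 * Z -
          t ^ 2 / 2 * Real.exp (t * M) * P).tendsto' 0 Z (by simp)).mono_left
        nhdsWithin_le_nhds).eventually_const_lt hZ0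
    have e2 : ∀ᶠ t : ℝ in nhdsWithin 0 (Set.Ioi 0), t < τ :=
      nhdsWithin_le_nhds (eventually_lt_nhds hτ)
    filter_upwards [e1, hpos 1, hpos (-1), e2, self_mem_nhdsWithin] with t h1 hp1 hp2 h2 h0
    rw [Set.mem_Ioi] at h0
    have l1 := hlow t t (abs_of_pos h0) h1.le
    have l2 := hlow (-t) t (by rw [abs_neg, abs_of_pos h0]) h1.le
    have hh := h t h0 h2.le
    have hprod := (mul_le_mul (a := Z + 1 * t * G + t ^ 2 / 2 * G2 - (t * M) ^ 3 * Z -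
          t ^ 2 / 2 * Real.exp (t * M) * P) (le_trans (le_of_eq (by ring)) l1)
      (le_trans (le_of_eq (by ring)) l2) hp2.le (integral_nonneg fun x => Real.exp_nonneg _)).trans
      hh
    -- The product of the two lower bounds is `(Z + E)² - t² G²`, with `E` the expression squared in
    -- the hint; `E²` is dropped.
    have hd : t ^ 2 * (Z * (G2 - Real.exp (t * M) * P) - 2 * M ^ 3 * Z ^ 2 * t) ≤
        t ^ 2 * G ^ 2 := by
      nlinarith [sq_nonneg (t ^ 2 / 2 * G2 - (t * M) ^ 3 * Z - t ^ 2 / 2 * Real.exp (t * M) * P)]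
    exact le_of_mul_le_mul_left hd (by positivity)
  have hlim : Tendsto (fun t : ℝ => Z * (G2 - Real.exp (t * M) * P) - 2 * M ^ 3 * Z ^ 2 * t)
      (nhdsWithin 0 (Set.Ioi 0)) (nhds (Z * (G2 - P))) :=
    ((by fun_prop : Continuous fun t : ℝ =>
      Z * (G2 - Real.exp (t * M) * P) - 2 * M ^ 3 * Z ^ 2 * t).tendsto' 0 _ (by simp)).mono_left
      nhdsWithin_le_nhds
  have := le_of_tendsto hlim hev
  linarith

/-! ### Compactly supported and bounded functions -/

section Variance

variable {n : ℕ} {φ g q : EuclideanSpace ℝ (Fin n) → ℝ}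

theorem mul_integral_sq_le_of_hasCompactSupport (hφ : ContDiff ℝ 2 φ)
    (hint : Integrable fun x => Real.exp (-φ x)) {ε : ℝ} (hε : 0 < ε)
    (hH : ∀ x v, ε * ‖v‖ ^ 2 ≤ inner ℝ (hessian φ x v) v)
    (hg : ContDiff ℝ 1 g) (hgs : HasCompactSupport g) (hq0 : ∀ x, 0 ≤ q x) (hqm : Measurable q)
    (hqi : Integrable q (gibbsMeasure φ))
    (hq : ∀ x w, 2 * inner ℝ (gradient g x) w - inner ℝ (hessian φ x w) w ≤ q x) :
    (gibbsMeasure φ).real Set.univ * ∫ x, g x ^ 2 ∂(gibbsMeasure φ) ≤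
      (∫ x, g x ∂(gibbsMeasure φ)) ^ 2 +
        (gibbsMeasure φ).real Set.univ * ∫ x, q x ∂(gibbsMeasure φ) := by
  have := isFiniteMeasure_gibbsMeasure hint
  obtain ⟨M, hM⟩ := hgs.exists_bound_of_continuous hg.continuous
  set Z := (gibbsMeasure φ).real Set.univ with hZ
  have hδ : ∀ δ > 0, Z * ∫ x, g x ^ 2 ∂(gibbsMeasure φ) ≤ (∫ x, g x ∂(gibbsMeasure φ)) ^ 2 +
      Z * (∫ x, q x ∂(gibbsMeasure φ) + Z * δ) := by
    intro δ hδ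
    obtain ⟨τ, hτ, h⟩ := exists_forall_le_add_bregman hφ hε hH hg hgs hq0 hq hδ
    have hi := hqi.add (integrable_const δ)
    have e : ∫ x, (q x + δ) ∂(gibbsMeasure φ) = ∫ x, q x ∂(gibbsMeasure φ) + Z * δ := by
      rw [integral_add hqi (integrable_const δ), integral_const, smul_eq_mul]
    rw [← e]
    refine mul_integral_sq_le_of_integral_exp_mul_integral_exp_le hg.continuous.measurable hM
      (hqm.add_const δ) (fun x => add_nonneg (hq0 x) hδ.le) hi hτ fun t ht htτ => ?_
    have hgm := hg.continuous.measurable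
    refine integral_exp_mul_integral_exp_le_of_midpoint hφ.continuous hint (by fun_prop)
      (by fun_prop) fun x y => ?_
    -- Bregman bounds centred at the midpoint: `t g m` and `-t g m` cancel, and so do the gradient
    -- terms.
    set m := (2⁻¹ : ℝ) • (x + y) with hm
    have h1 := h t (by rwa [abs_of_pos ht]) x m
    have h2 := h (-t) (by rwa [abs_neg, abs_of_pos ht]) y m
    have h3 : inner ℝ (gradient φ m) (x - m) + inner ℝ (gradient φ m) (y - m) = 0 := by
      rw [← inner_add_right, show x - m + (y - m) = 0 by rw [hm]; module, inner_zero_right]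
    rw [neg_sq] at h2
    linarith
  have hlim : Tendsto (fun δ : ℝ => (∫ x, g x ∂(gibbsMeasure φ)) ^ 2 +
      Z * (∫ x, q x ∂(gibbsMeasure φ) + Z * δ)) (nhdsWithin 0 (Set.Ioi 0))
      (nhds ((∫ x, g x ∂(gibbsMeasure φ)) ^ 2 + Z * ∫ x, q x ∂(gibbsMeasure φ))) :=
    ((by fun_prop : Continuous fun δ : ℝ => (∫ x, g x ∂(gibbsMeasure φ)) ^ 2 +
      Z * (∫ x, q x ∂(gibbsMeasure φ) + Z * δ)).tendsto' 0 _ (by simp)).mono_left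
      nhdsWithin_le_nhds
  refine ge_of_tendsto hlim ?_
  filter_upwards [self_mem_nhdsWithin] with δ h using hδ δ h

/-- Cutoffs change the dual quadratic form in a controlled way. -/
theorem two_mul_inner_sub_inner_le_of_cutoff {E : Type*} [NormedAddCommGroup E]
    [InnerProductSpace ℝ E] {A : E →L[ℝ] E} {v d : E} {ε Q χ γ M C u : ℝ} (hε : 0 < ε)
    (hA : ∀ w, ε * ‖w‖ ^ 2 ≤ inner ℝ (A w) w) (hQ0 : 0 ≤ Q)
    (hQ : ∀ w, 2 * inner ℝ v w - inner ℝ (A w) w ≤ Q) (hχ0 : 0 ≤ χ) (hχ1 : χ ≤ 1)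
    (hγ : |γ| ≤ M) (hu : 0 < u) (hd : ‖d‖ ≤ C * u) (w : E) :
    2 * inner ℝ (χ • v + γ • d) w - inner ℝ (A w) w ≤
      (1 + u) * Q + M ^ 2 * C ^ 2 / ε * (u * (1 + u)) := by
  have hM : 0 ≤ M := (abs_nonneg γ).trans hγ
  have hAw : 0 ≤ inner ℝ (A w) w := le_trans (by positivity) (hA w)
  -- The form `⟨A w, w⟩` is split: the share `1/(1 + u)` controls `χ • v`, the remaining `u/(1 + u)`
  -- controls `γ • d`.
  have h1 := hQ ((1 + u)⁻¹ • w)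
  rw [map_smul, inner_smul_left, inner_smul_right, inner_smul_right] at h1
  simp only [conj_trivial] at h1
  have h1' : 2 * inner ℝ v w - (1 + u)⁻¹ * inner ℝ (A w) w ≤ (1 + u) * Q := by
    have := mul_le_mul_of_nonneg_left h1 (by positivity : 0 ≤ 1 + u)
    refine le_trans (le_of_eq ?_) this
    field_simp
  have h2 : 2 * χ * inner ℝ v w - (1 + u)⁻¹ * inner ℝ (A w) w ≤ (1 + u) * Q := by
    have a1 : 0 ≤ (1 + u) * Q := by positivity
    have a2 : 0 ≤ (1 + u)⁻¹ * inner ℝ (A w) w := by positivity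
    nlinarith
  have h3 : 2 * γ * inner ℝ d w - (1 - (1 + u)⁻¹) * inner ℝ (A w) w ≤
      M ^ 2 * C ^ 2 / ε * (u * (1 + u)) := by
    have a1 : γ * inner ℝ d w ≤ M * (C * u * ‖w‖) := by
      refine (le_abs_self _).trans ?_
      rw [abs_mul]
      gcongr
      exact (abs_real_inner_le_norm d w).trans (by gcongr)
    have a2 : 1 - (1 + u)⁻¹ = u / (1 + u) := by field_simp; ring
    rw [a2]
    have a3 : u / (1 + u) * (ε * ‖w‖ ^ 2) ≤ u / (1 + u) * inner ℝ (A w) w := by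
      gcongr
      exact hA w
    have a4 : 2 * (M * (C * u * ‖w‖)) - u / (1 + u) * (ε * ‖w‖ ^ 2) =
        M ^ 2 * C ^ 2 / ε * (u * (1 + u)) -
          u / (ε * (1 + u)) * (ε * ‖w‖ - (1 + u) * (M * C)) ^ 2 := by
      field_simp
      ring
    have a5 : 0 ≤ u / (ε * (1 + u)) * (ε * ‖w‖ - (1 + u) * (M * C)) ^ 2 := by positivity
    linarith
  rw [inner_add_left, inner_smul_left, inner_smul_left]
  simp only [conj_trivial]
  linarith

theorem gradient_mul_eq {χ : EuclideanSpace ℝ (Fin n) → ℝ} (hχ : ContDiff ℝ 1 χ)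
    (hg : ContDiff ℝ 1 g) (x : EuclideanSpace ℝ (Fin n)) :
    gradient (fun y => χ y * g y) x = χ x • gradient g x + g x • gradient χ x := by
  have h := fderiv_fun_mul (hχ.differentiable (by norm_num) x) (hg.differentiable (by norm_num) x)
  simp only [gradient, h, map_add, map_smulₛₗ]
  simp

theorem gradient_comp_smul {χ : EuclideanSpace ℝ (Fin n) → ℝ} (u : ℝ)
    (x : EuclideanSpace ℝ (Fin n)) :
    gradient (fun y => χ (u • y)) x = u • gradient χ (u • x) := by
  simp only [gradient]
  rw [fderiv_comp_smul]
  simp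

/-- The cutoffs `χ(x/(k + 1))` have gradients of order `1/(k + 1)`; since `g` is bounded and the
Hessian coercive, their cost in the dual form vanishes in the limit. -/
theorem mul_integral_sq_le_of_bounded (hφ : ContDiff ℝ 2 φ)
    (hint : Integrable fun x => Real.exp (-φ x)) {ε M : ℝ} (hε : 0 < ε)
    (hH : ∀ x v, ε * ‖v‖ ^ 2 ≤ inner ℝ (hessian φ x v) v)
    (hg : ContDiff ℝ 1 g) (hgM : ∀ x, |g x| ≤ M) (hq0 : ∀ x, 0 ≤ q x) (hqm : Measurable q)
    (hqi : Integrable q (gibbsMeasure φ))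
    (hq : ∀ x w, 2 * inner ℝ (gradient g x) w - inner ℝ (hessian φ x w) w ≤ q x) :
    (gibbsMeasure φ).real Set.univ * ∫ x, g x ^ 2 ∂(gibbsMeasure φ) ≤
      (∫ x, g x ∂(gibbsMeasure φ)) ^ 2 +
        (gibbsMeasure φ).real Set.univ * ∫ x, q x ∂(gibbsMeasure φ) := by
  have := isFiniteMeasure_gibbsMeasure hint
  set Z := (gibbsMeasure φ).real Set.univ with hZ
  let f : ContDiffBump (0 : EuclideanSpace ℝ (Fin n)) := ⟨1, 2, one_pos, one_lt_two⟩
  have hf : ContDiff ℝ 1 f := f.contDiff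
  obtain ⟨C, hC0, hC⟩ := hf.exists_norm_gradient_le f.hasCompactSupport
  let u : ℕ → ℝ := fun k => 1 / ((k : ℝ) + 1)
  have hu0 : ∀ k, 0 < u k := fun k => by positivity
  have hu : Tendsto u atTop (nhds 0) := tendsto_one_div_add_atTop_nhds_zero_nat
  let χ : ℕ → EuclideanSpace ℝ (Fin n) → ℝ := fun k x => f (u k • x)
  have hχ : ∀ k, ContDiff ℝ 1 (χ k) := fun k => hf.comp (contDiff_const_smul (u k))
  have hχs : ∀ k, HasCompactSupport (χ k) := fun k =>
    f.hasCompactSupport.comp_smul (hu0 k).ne'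
  have hχ0 : ∀ k x, 0 ≤ χ k x := fun k x => f.nonneg
  have hχ1 : ∀ k x, χ k x ≤ 1 := fun k x => f.le_one
  have hχlim : ∀ x, Tendsto (fun k => χ k x) atTop (nhds 1) := fun x => by
    have h1 : Tendsto (fun k => u k • x) atTop (nhds 0) := by simpa using hu.smul_const x
    have h2 : Tendsto f (nhds 0) (nhds 1) :=
      f.continuous.tendsto' _ _ (f.one_of_mem_closedBall (by simp [f.rIn_pos.le]))
    exact h2.comp h1
  have hχg : ∀ k x, |χ k x * g x| ≤ M := fun k x => by
    rw [abs_mul, abs_of_nonneg (hχ0 k x)]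
    exact (mul_le_of_le_one_left (abs_nonneg _) (hχ1 k x)).trans (hgM x)
  set D := M ^ 2 * C ^ 2 / ε with hD
  have hD0 : 0 ≤ D := by positivity
  have key : ∀ k, Z * ∫ x, (χ k x * g x) ^ 2 ∂(gibbsMeasure φ) ≤
      (∫ x, χ k x * g x ∂(gibbsMeasure φ)) ^ 2 +
        Z * ((1 + u k) * ∫ x, q x ∂(gibbsMeasure φ) + Z * (D * (u k * (1 + u k)))) := by
    intro k
    have hi : Integrable (fun x => (1 + u k) * q x + D * (u k * (1 + u k))) (gibbsMeasure φ) :=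
      (hqi.const_mul _).add (integrable_const _)
    have e : ∫ x, ((1 + u k) * q x + D * (u k * (1 + u k))) ∂(gibbsMeasure φ) =
        (1 + u k) * ∫ x, q x ∂(gibbsMeasure φ) + Z * (D * (u k * (1 + u k))) := by
      rw [integral_add (hqi.const_mul _) (integrable_const _), integral_const_mul, integral_const,
        smul_eq_mul]
    rw [← e]
    have := hu0 k
    refine mul_integral_sq_le_of_hasCompactSupport hφ hint hε hH ((hχ k).mul hg)
      (hχs k).mul_right (fun x => ?_) (by fun_prop) hi fun x w => ?_
    · have := hq0 x
      positivity
    · rw [gradient_mul_eq (hχ k) hg]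
      refine two_mul_inner_sub_inner_le_of_cutoff hε (hH x) (hq0 x) (hq x) (hχ0 k x) (hχ1 k x)
        (hgM x) this ?_ w
      rw [gradient_comp_smul, norm_smul, Real.norm_of_nonneg this.le, mul_comm]
      gcongr
      exact hC _
  have hgm := hg.continuous.measurable
  have hχm : ∀ k, Measurable (χ k) := fun k => (hχ k).continuous.measurable
  have lim1 : Tendsto (fun k => ∫ x, χ k x * g x ∂(gibbsMeasure φ)) atTop
      (nhds (∫ x, g x ∂(gibbsMeasure φ))) := by
    refine tendsto_integral_of_dominated_convergence (fun _ => M)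
      (fun k => ((hχm k).mul hgm).aestronglyMeasurable) (integrable_const _)
      (fun k => ae_of_all _ (hχg k)) (ae_of_all _ fun x => ?_)
    simpa using (hχlim x).mul_const (g x)
  have lim2 : Tendsto (fun k => ∫ x, (χ k x * g x) ^ 2 ∂(gibbsMeasure φ)) atTop
      (nhds (∫ x, g x ^ 2 ∂(gibbsMeasure φ))) := by
    refine tendsto_integral_of_dominated_convergence (fun _ => M ^ 2)
      (fun k => (((hχm k).mul hgm).pow_const 2).aestronglyMeasurable) (integrable_const _)
      (fun k => ae_of_all _ fun x => ?_) (ae_of_all _ fun x => ?_)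
    · rw [Real.norm_of_nonneg (sq_nonneg _), ← sq_abs]
      have := hχg k x
      gcongr
    · simpa using ((hχlim x).mul_const (g x)).pow 2
  have lim3 : Tendsto (fun k => (∫ x, χ k x * g x ∂(gibbsMeasure φ)) ^ 2 +
      Z * ((1 + u k) * ∫ x, q x ∂(gibbsMeasure φ) + Z * (D * (u k * (1 + u k))))) atTop
      (nhds ((∫ x, g x ∂(gibbsMeasure φ)) ^ 2 +
      Z * ((1 + 0) * ∫ x, q x ∂(gibbsMeasure φ) + Z * (D * (0 * (1 + 0)))))) :=
    (lim1.pow 2).add ((((hu.const_add 1).mul_const _).add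
      (((hu.mul (hu.const_add 1)).const_mul D).const_mul Z)).const_mul Z)
  simpa using le_of_tendsto_of_tendsto' (lim2.const_mul Z) lim3 key

end Variance

/-! ### The dual quadratic form -/

section QuadForm

variable {n : ℕ} {A : EuclideanSpace ℝ (Fin n) →L[ℝ] EuclideanSpace ℝ (Fin n)}

theorem isInvertible_of_coercive {ε : ℝ} (hε : 0 < ε)
    (hA : ∀ v, ε * ‖v‖ ^ 2 ≤ inner ℝ (A v) v) : A.IsInvertible := by
  have hinj : Function.Injective A.toLinearMap := by
    rw [← LinearMap.ker_eq_bot, LinearMap.ker_eq_bot']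
    intro v hv
    have h1 := hA v
    rw [show A v = 0 from hv, inner_zero_left] at h1
    have h2 : ‖v‖ ^ 2 ≤ 0 := by
      by_contra h
      rw [not_le] at h
      nlinarith
    simpa using le_antisymm h2 (sq_nonneg _)
  refine ⟨(LinearEquiv.ofInjectiveEndo A.toLinearMap hinj).toContinuousLinearEquiv, ?_⟩
  ext v
  rfl

/-- Expand `⟨A (w - u), w - u⟩ ≥ 0`. Thus `v · A⁻¹ v` is an admissible bound `q`. -/
theorem two_mul_inner_sub_inner_le_of_apply_eq (hs : ∀ v w, inner ℝ (A v) w = inner ℝ v (A w))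
    (h0 : ∀ v, 0 ≤ inner ℝ (A v) v) {u v : EuclideanSpace ℝ (Fin n)} (hu : A u = v)
    (w : EuclideanSpace ℝ (Fin n)) : 2 * inner ℝ v w - inner ℝ (A w) w ≤ inner ℝ v u := by
  have h1 := h0 (w - u)
  have h2 : inner ℝ (A w) u = inner ℝ v w := by rw [hs, hu, real_inner_comm]
  rw [map_sub, hu, inner_sub_left, inner_sub_right, inner_sub_right, h2] at h1
  linarith

theorem le_invQuadForm {c : ℝ≥0∞} {v : EuclideanSpace ℝ (Fin n)}
    (h : ∀ w, A w = v → c ≤ ENNReal.ofReal (inner ℝ v w)) : c ≤ invQuadForm A v := by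
  rw [invQuadForm]
  split_ifs with hA
  · exact h _ (hA.self_apply_inverse v)
  · exact le_iInf₂ h

/-- Monotonicity `(A + ε)⁻¹ ≤ A⁻¹` of the dual form, valid also for singular `A`: this makes the
regularised energies bounded by the original one. -/
theorem ofReal_inner_le_invQuadForm (hs : ∀ v w, inner ℝ (A v) w = inner ℝ v (A w))
    (h0 : ∀ v, 0 ≤ inner ℝ (A v) v) {ε : ℝ} (hε : 0 ≤ ε) {u v : EuclideanSpace ℝ (Fin n)}
    (hu : A u + ε • u = v) : ENNReal.ofReal (inner ℝ v u) ≤ invQuadForm A v := by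
  refine le_invQuadForm fun w hw => ENNReal.ofReal_le_ofReal ?_
  have h1 := two_mul_inner_sub_inner_le_of_apply_eq hs h0 hw u
  have h2 : inner ℝ v u = inner ℝ (A u) u + ε * inner ℝ u u := by
    rw [← hu, inner_add_left, inner_smul_left]
    rfl
  have h3 : 0 ≤ ε * inner ℝ u u := mul_nonneg hε real_inner_self_nonneg
  linarith

theorem invQuadForm_smul_le {c : ℝ} (hc : |c| ≤ 1) (v : EuclideanSpace ℝ (Fin n)) :
    invQuadForm A (c • v) ≤ invQuadForm A v := by
  have hle : ∀ r : ℝ, ENNReal.ofReal (c * (c * r)) ≤ ENNReal.ofReal r := fun r => by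
    rw [← mul_assoc, ENNReal.ofReal_mul (mul_self_nonneg c)]
    refine mul_le_of_le_one_left zero_le ?_
    rw [ENNReal.ofReal_le_one, ← sq, sq_le_one_iff_abs_le_one]
    exact hc
  rw [invQuadForm, invQuadForm]
  split_ifs with hA
  · rw [map_smul, inner_smul_left, inner_smul_right]
    exact hle _
  · refine le_iInf₂ fun w hw => iInf₂_le_of_le (c • w) (by rw [map_smul, hw]) ?_
    rw [inner_smul_left, inner_smul_right]
    exact hle _

end QuadForm

/-! ### Removing uniform convexity by a quadratic perturbation -/

section Perturbation

variable {n : ℕ} {φ g : EuclideanSpace ℝ (Fin n) → ℝ}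

theorem gradient_add_sq_norm (hφ : ContDiff ℝ 2 φ) (ε : ℝ) :
    gradient (fun x => φ x + ε / 2 * ‖x‖ ^ 2) = fun x => gradient φ x + ε • x := by
  funext x
  refine ext_inner_right ℝ fun w => ?_
  have h1 := (hφ.differentiable (by norm_num) x).hasFDerivAt
  have h2 := (hasStrictFDerivAt_norm_sq x).hasFDerivAt.const_mul (ε / 2)
  rw [inner_gradient_left, (h1.fun_add h2).fderiv, inner_add_left, inner_gradient_left,
    inner_smul_left]
  simp
  ring

theorem hessian_add_sq_norm_apply (hφ : ContDiff ℝ 2 φ) (ε : ℝ) (x v : EuclideanSpace ℝ (Fin n)) :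
    hessian (fun x => φ x + ε / 2 * ‖x‖ ^ 2) x v = hessian φ x v + ε • v := by
  have h : HasFDerivAt (fun x => gradient φ x + ε • x)
      (hessian φ x + ε • ContinuousLinearMap.id ℝ (EuclideanSpace ℝ (Fin n))) x :=
    (hφ.hasFDerivAt_gradient x).add ((hasFDerivAt_id x).const_smul ε)
  rw [hessian, gradient_add_sq_norm hφ, h.fderiv]
  rfl

theorem ContDiff.add_sq_norm (hφ : ContDiff ℝ 2 φ) (ε : ℝ) :
    ContDiff ℝ 2 fun x => φ x + ε / 2 * ‖x‖ ^ 2 :=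
  hφ.add (contDiff_const.mul (contDiff_norm_sq ℝ))

theorem gibbsMeasure_add_sq_norm_le {ε : ℝ} (hε : 0 ≤ ε) :
    gibbsMeasure (fun x => φ x + ε / 2 * ‖x‖ ^ 2) ≤ gibbsMeasure φ := by
  refine withDensity_mono (ae_of_all _ fun x => ENNReal.ofReal_le_ofReal (Real.exp_le_exp.2 ?_))
  have : 0 ≤ ε / 2 * ‖x‖ ^ 2 := by positivity
  linarith

theorem tendsto_integral_gibbsMeasure_add_sq_norm (hφ : Continuous φ)
    (hint : Integrable fun x => Real.exp (-φ x)) {f : EuclideanSpace ℝ (Fin n) → ℝ} {M : ℝ}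
    (hf : Continuous f) (hfM : ∀ x, |f x| ≤ M) {u : ℕ → ℝ} (hu0 : ∀ k, 0 ≤ u k)
    (hu : Tendsto u atTop (nhds 0)) :
    Tendsto (fun k => ∫ x, f x ∂(gibbsMeasure fun x => φ x + u k / 2 * ‖x‖ ^ 2)) atTop
      (nhds (∫ x, f x ∂(gibbsMeasure φ))) := by
  have hc : ∀ k, Continuous fun x => φ x + u k / 2 * ‖x‖ ^ 2 := fun k => by fun_prop
  simp only [integral_gibbsMeasure (hc _), integral_gibbsMeasure hφ]
  refine tendsto_integral_of_dominated_convergence (fun x => Real.exp (-φ x) * M)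
    (fun k => Continuous.aestronglyMeasurable (by fun_prop)) (hint.mul_const M)
    (fun k => ae_of_all _ fun x => ?_) (ae_of_all _ fun x => ?_)
  · rw [norm_mul, Real.norm_of_nonneg (Real.exp_nonneg _)]
    have h1 : 0 ≤ u k / 2 * ‖x‖ ^ 2 := by have := hu0 k; positivity
    have h2 := hfM x
    have h3 : -(φ x + u k / 2 * ‖x‖ ^ 2) ≤ -φ x := by linarith
    rw [Real.norm_eq_abs]
    gcongr
  · have h1 : Continuous fun s : ℝ => Real.exp (-(φ x + s / 2 * ‖x‖ ^ 2)) * f x := by fun_prop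
    exact (h1.tendsto' 0 _ (by simp)).comp hu

theorem ofReal_integral_sq_sub_le_of_bounded (hφ : ContDiff ℝ 2 φ) (hc : ConvexOn ℝ Set.univ φ)
    (hprob : ∫ x, Real.exp (-φ x) = 1) (hg : ContDiff ℝ 1 g) {M : ℝ} (hgM : ∀ x, |g x| ≤ M) :
    ENNReal.ofReal (∫ x, g x ^ 2 ∂(gibbsMeasure φ) - (∫ x, g x ∂(gibbsMeasure φ)) ^ 2) ≤
      ∫⁻ x, invQuadForm (hessian φ x) (gradient g x) ∂(gibbsMeasure φ) := by
  have hint : Integrable fun x => Real.exp (-φ x) :=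
    Integrable.of_integral_ne_zero (by rw [hprob]; exact one_ne_zero)
  set I := ∫⁻ x, invQuadForm (hessian φ x) (gradient g x) ∂(gibbsMeasure φ) with hI
  rcases eq_or_ne I ∞ with hItop | hItop
  · rw [hItop]
    exact le_top
  let u : ℕ → ℝ := fun k => 1 / ((k : ℝ) + 1)
  have hu0 : ∀ k, 0 < u k := fun k => by positivity
  have hu : Tendsto u atTop (nhds 0) := tendsto_one_div_add_atTop_nhds_zero_nat
  let ψ : ℕ → EuclideanSpace ℝ (Fin n) → ℝ := fun k x => φ x + u k / 2 * ‖x‖ ^ 2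
  have hψ : ∀ k, ContDiff ℝ 2 (ψ k) := fun k => hφ.add_sq_norm (u k)
  have hψint : ∀ k, Integrable fun x => Real.exp (-ψ k x) := fun k => by
    refine hint.mono (by have := (hψ k).continuous; fun_prop) (ae_of_all _ fun x => ?_)
    rw [Real.norm_of_nonneg (Real.exp_nonneg _), Real.norm_of_nonneg (Real.exp_nonneg _)]
    have h1 : 0 ≤ u k / 2 * ‖x‖ ^ 2 := by have := hu0 k; positivity
    exact Real.exp_le_exp.2 (neg_le_neg (le_add_of_nonneg_right h1))
  have h0 := hc.inner_hessian_nonneg hφ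
  have hψH : ∀ k x v, u k * ‖v‖ ^ 2 ≤ inner ℝ (hessian (ψ k) x v) v := fun k x v => by
    rw [hessian_add_sq_norm_apply hφ, inner_add_left, inner_smul_left, real_inner_self_eq_norm_sq]
    simpa using h0 x v
  have hinv : ∀ k x, (hessian (ψ k) x).IsInvertible := fun k x =>
    isInvertible_of_coercive (hu0 k) (hψH k x)
  let q : ℕ → EuclideanSpace ℝ (Fin n) → ℝ := fun k x =>
    inner ℝ (gradient g x) ((hessian (ψ k) x).inverse (gradient g x))
  have hqc : ∀ k, Continuous (q k) := fun k => by
    have h1 : Continuous fun x => (hessian (ψ k) x).inverse := by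
      refine continuous_iff_continuousAt.2 fun x => ?_
      exact ((hinv k x).contDiffAt_map_inverse (n := 0)).continuousAt.comp
        (hψ k).continuous_hessian.continuousAt
    exact hg.continuous_gradient.inner (h1.clm_apply hg.continuous_gradient)
  have hq : ∀ k x w, 2 * inner ℝ (gradient g x) w - inner ℝ (hessian (ψ k) x w) w ≤ q k x :=
    fun k x w => two_mul_inner_sub_inner_le_of_apply_eq ((hψ k).inner_hessian_comm x)
      (fun v => le_trans (by have := hu0 k; positivity) (hψH k x v))
      ((hinv k x).self_apply_inverse _) w
  have hq0 : ∀ k x, 0 ≤ q k x := fun k x => by simpa using hq k x 0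
  have hqI : ∀ k, ∫⁻ x, ENNReal.ofReal (q k x) ∂(gibbsMeasure (ψ k)) ≤ I := fun k => by
    -- Measure and integrand both increase when the perturbation is removed. The comparison is
    -- pointwise, so no measurability of `invQuadForm` is needed.
    refine lintegral_mono' (gibbsMeasure_add_sq_norm_le (hu0 k).le) fun x => ?_
    refine ofReal_inner_le_invQuadForm (hφ.inner_hessian_comm x) (h0 x) (hu0 k).le ?_
    rw [← hessian_add_sq_norm_apply hφ]
    exact (hinv k x).self_apply_inverse _
  have hqi : ∀ k, Integrable (q k) (gibbsMeasure (ψ k)) := fun k => by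
    refine ⟨(hqc k).aestronglyMeasurable, ?_⟩
    rw [hasFiniteIntegral_iff_ofReal (ae_of_all _ (hq0 k))]
    exact (hqI k).trans_lt hItop.lt_top
  have hqI' : ∀ k, ∫ x, q k x ∂(gibbsMeasure (ψ k)) ≤ I.toReal := fun k => by
    rw [integral_eq_lintegral_of_nonneg_ae (ae_of_all _ (hq0 k)) (hqc k).aestronglyMeasurable]
    exact ENNReal.toReal_mono hItop (hqI k)
  -- The total mass is written as the integral of `1`, so that one limit statement covers it as
  -- well.
  have huniv : ∀ χ : EuclideanSpace ℝ (Fin n) → ℝ,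
      (gibbsMeasure χ).real Set.univ = ∫ _, (1 : ℝ) ∂(gibbsMeasure χ) := fun χ => by simp
  have key : ∀ k, (∫ _, (1 : ℝ) ∂(gibbsMeasure (ψ k))) * ∫ x, g x ^ 2 ∂(gibbsMeasure (ψ k)) ≤
      (∫ x, g x ∂(gibbsMeasure (ψ k))) ^ 2 + (∫ _, (1 : ℝ) ∂(gibbsMeasure (ψ k))) * I.toReal := by
    intro k
    rw [← huniv]
    refine (mul_integral_sq_le_of_bounded (hψ k) (hψint k) (hu0 k) (hψH k) hg hgM (hq0 k)
      (hqc k).measurable (hqi k) (hq k)).trans ?_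
    have := hqI' k
    gcongr
  have hlim : ∀ (f : EuclideanSpace ℝ (Fin n) → ℝ) (B : ℝ), Continuous f → (∀ x, |f x| ≤ B) →
      Tendsto (fun k => ∫ x, f x ∂(gibbsMeasure (ψ k))) atTop
        (nhds (∫ x, f x ∂(gibbsMeasure φ))) := fun f B hf hfB =>
    tendsto_integral_gibbsMeasure_add_sq_norm hφ.continuous hint hf hfB (fun k => (hu0 k).le) hu
  have lim0 := hlim (fun _ => 1) 1 continuous_const (by simp)
  have lim1 := hlim g M hg.continuous hgM
  have lim2 := hlim (fun x => g x ^ 2) (M ^ 2) (hg.continuous.pow 2) fun x => by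
    rw [abs_pow]
    have := hgM x
    gcongr
  have hone : ∫ _, (1 : ℝ) ∂(gibbsMeasure φ) = 1 := by
    rw [integral_gibbsMeasure hφ.continuous]
    simpa using hprob
  have := le_of_tendsto_of_tendsto' (lim0.mul lim2) ((lim1.pow 2).add (lim0.mul_const I.toReal)) key
  rw [hone, one_mul, one_mul] at this
  exact ENNReal.ofReal_le_of_le_toReal (by linarith)

theorem isProbabilityMeasure_gibbsMeasure (hφ : Continuous φ)
    (hprob : ∫ x, Real.exp (-φ x) = 1) : IsProbabilityMeasure (gibbsMeasure φ) := by
  have hint : Integrable fun x => Real.exp (-φ x) :=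
    Integrable.of_integral_ne_zero (by rw [hprob]; exact one_ne_zero)
  refine ⟨?_⟩
  have h := lintegral_gibbsMeasure hφ 1
  simp only [Pi.one_apply, lintegral_one, mul_one] at h
  rw [h, ← ofReal_integral_eq_lintegral_ofReal hint (ae_of_all _ fun x => Real.exp_nonneg _), hprob,
    ENNReal.ofReal_one]

theorem lintegral_ofReal_sq_sub_integral_le_of_bounded (hφ : ContDiff ℝ 2 φ)
    (hc : ConvexOn ℝ Set.univ φ) (hprob : ∫ x, Real.exp (-φ x) = 1) (hg : ContDiff ℝ 1 g) {M : ℝ}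
    (hgM : ∀ x, |g x| ≤ M) :
    ∫⁻ x, ENNReal.ofReal ((g x - ∫ y, g y ∂(gibbsMeasure φ)) ^ 2) ∂(gibbsMeasure φ) ≤
      ∫⁻ x, invQuadForm (hessian φ x) (gradient g x) ∂(gibbsMeasure φ) := by
  refine le_trans (le_of_eq ?_) (ofReal_integral_sq_sub_le_of_bounded hφ hc hprob hg hgM)
  have := isProbabilityMeasure_gibbsMeasure hφ.continuous hprob
  have hL : MemLp g 2 (gibbsMeasure φ) :=
    MemLp.of_bound hg.continuous.aestronglyMeasurable M (ae_of_all _ hgM)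
  have hi : Integrable (fun x => (g x - ∫ y, g y ∂(gibbsMeasure φ)) ^ 2) (gibbsMeasure φ) :=
    (hL.sub (memLp_const (∫ y, g y ∂(gibbsMeasure φ)))).integrable_sq
  rw [← ofReal_integral_eq_lintegral_ofReal hi (ae_of_all _ fun x => sq_nonneg _)]
  congr 1
  rw [← ProbabilityTheory.variance_eq_integral hL.aestronglyMeasurable.aemeasurable,
    ProbabilityTheory.variance_eq_sub hL]
  rfl

end Perturbation

/-! ### Truncation and the general case -/

section Truncation

/-- The truncation `s / (1 + a s²)` is smooth and bounded for `a > 0`, is dominated by `|s|`, and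
has slope at most `1` in absolute value, so composing with it does not increase the energy. -/
theorem hasDerivAt_div_one_add_mul_sq {a : ℝ} (ha : 0 ≤ a) (s : ℝ) :
    HasDerivAt (fun s : ℝ => s / (1 + a * s ^ 2)) ((1 - a * s ^ 2) / (1 + a * s ^ 2) ^ 2) s := by
  have hne : 1 + a * s ^ 2 ≠ 0 := by positivity
  have h := (hasDerivAt_id s).div ((((hasDerivAt_id s).pow 2).const_mul a).const_add 1) hne
  refine h.congr_deriv ?_
  simp
  ring

theorem contDiff_div_one_add_mul_sq {a : ℝ} (ha : 0 ≤ a) :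
    ContDiff ℝ 1 fun s : ℝ => s / (1 + a * s ^ 2) :=
  contDiff_id.div (contDiff_const.add (contDiff_const.mul (contDiff_id.pow 2))) fun s =>
    (by positivity : (0 : ℝ) < 1 + a * s ^ 2).ne'

theorem abs_deriv_div_one_add_mul_sq_le {a : ℝ} (ha : 0 ≤ a) (s : ℝ) :
    |(1 - a * s ^ 2) / (1 + a * s ^ 2) ^ 2| ≤ 1 := by
  have h : 0 ≤ a * s ^ 2 := by positivity
  rw [abs_div, abs_of_pos (by positivity : 0 < (1 + a * s ^ 2) ^ 2), div_le_one (by positivity),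
    abs_le]
  constructor <;> nlinarith

theorem abs_div_one_add_mul_sq_le_abs {a : ℝ} (ha : 0 ≤ a) (s : ℝ) :
    |s / (1 + a * s ^ 2)| ≤ |s| := by
  have h : 0 ≤ a * s ^ 2 := by positivity
  rw [abs_div, abs_of_pos (by positivity : 0 < 1 + a * s ^ 2)]
  exact div_le_self (abs_nonneg s) (by linarith)

theorem abs_div_one_add_mul_sq_le {a : ℝ} (ha : 0 < a) (s : ℝ) :
    |s / (1 + a * s ^ 2)| ≤ 1 + 1 / a := by
  rw [abs_div, abs_of_pos (by positivity : 0 < 1 + a * s ^ 2), div_le_iff₀ (by positivity)]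
  have h1 : (1 + 1 / a) * (1 + a * s ^ 2) = 1 + 1 / a + a * s ^ 2 + s ^ 2 := by
    field_simp
    ring
  have h2 : 0 < 1 / a := by positivity
  have h3 : 0 ≤ a * s ^ 2 := by positivity
  rw [h1]
  nlinarith [sq_abs s, sq_nonneg (|s| - 1)]

theorem gradient_comp_real {n : ℕ} {g : EuclideanSpace ℝ (Fin n) → ℝ} {T : ℝ → ℝ} {T' : ℝ}
    {x : EuclideanSpace ℝ (Fin n)} (hg : DifferentiableAt ℝ g x) (hT : HasDerivAt T T' (g x)) :
    gradient (fun y => T (g y)) x = T' • gradient g x := by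
  simp only [gradient]
  rw [show (fun y => T (g y)) = T ∘ g from rfl, (hT.comp_hasFDerivAt x hg.hasFDerivAt).fderiv]
  simp

end Truncation

theorem mainTheorem4 (n : ℕ) (φ : EuclideanSpace ℝ (Fin n) → ℝ)
    (hφ_smooth : ContDiff ℝ 2 φ)
    (hφ_convex : StrictConvexOn ℝ Set.univ φ)
    (hφ_growth : Tendsto (fun x => φ x / ‖x‖)
      (Bornology.cobounded (EuclideanSpace ℝ (Fin n))) atTop)
    (hφ_prob : ∫ x, Real.exp (-φ x) = 1)
    (g : EuclideanSpace ℝ (Fin n) → ℝ)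
    (hg_smooth : ContDiff ℝ 1 g)
    (hg_int : Integrable g (gibbsMeasure φ)) :
    ∫⁻ x, ENNReal.ofReal ((g x - ∫ y, g y ∂(gibbsMeasure φ)) ^ 2) ∂(gibbsMeasure φ) ≤
      ∫⁻ x, invQuadForm (hessian φ x) (gradient g x) ∂(gibbsMeasure φ) := by
  let u : ℕ → ℝ := fun k => 1 / ((k : ℝ) + 1)
  have hu0 : ∀ k, 0 < u k := fun k => by positivity
  have hu : Tendsto u atTop (nhds 0) := tendsto_one_div_add_atTop_nhds_zero_nat
  let G : ℕ → EuclideanSpace ℝ (Fin n) → ℝ := fun k x => g x / (1 + u k * g x ^ 2)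
  have hG : ∀ k, ContDiff ℝ 1 (G k) := fun k =>
    (contDiff_div_one_add_mul_sq (hu0 k).le).comp hg_smooth
  have hGlim : ∀ x, Tendsto (fun k => G k x) atTop (nhds (g x)) := fun x => by
    have h : Tendsto (fun k => 1 + u k * g x ^ 2) atTop (nhds 1) := by
      simpa using (hu.mul_const (g x ^ 2)).const_add 1
    have h2 := (tendsto_const_nhds (x := g x)).div h one_ne_zero
    rwa [div_one] at h2
  have hmean : Tendsto (fun k => ∫ y, G k y ∂(gibbsMeasure φ)) atTop
      (nhds (∫ y, g y ∂(gibbsMeasure φ))) :=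
    tendsto_integral_of_dominated_convergence (fun x => |g x|)
      (fun k => (hG k).continuous.aestronglyMeasurable) hg_int.abs
      (fun k => ae_of_all _ fun x => abs_div_one_add_mul_sq_le_abs (hu0 k).le (g x))
      (ae_of_all _ hGlim)
  have hbd : ∀ k, ∫⁻ x, ENNReal.ofReal ((G k x - ∫ y, G k y ∂(gibbsMeasure φ)) ^ 2)
      ∂(gibbsMeasure φ) ≤ ∫⁻ x, invQuadForm (hessian φ x) (gradient g x) ∂(gibbsMeasure φ) := by
    intro k
    refine (lintegral_ofReal_sq_sub_integral_le_of_bounded hφ_smooth hφ_convex.convexOn hφ_prob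
      (hG k) fun x => abs_div_one_add_mul_sq_le (hu0 k) (g x)).trans (lintegral_mono fun x => ?_)
    rw [gradient_comp_real (hg_smooth.differentiable (by norm_num) x)
      (hasDerivAt_div_one_add_mul_sq (hu0 k).le (g x))]
    exact invQuadForm_smul_le (abs_deriv_div_one_add_mul_sq_le (hu0 k).le (g x)) _
  have hlim : ∀ x, Tendsto (fun k => ENNReal.ofReal ((G k x - ∫ y, G k y ∂(gibbsMeasure φ)) ^ 2))
      atTop (nhds (ENNReal.ofReal ((g x - ∫ y, g y ∂(gibbsMeasure φ)) ^ 2))) := fun x =>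
    ENNReal.tendsto_ofReal (((hGlim x).sub hmean).pow 2)
  -- Only integrability of `g` is known, enough for the means to converge; Fatou's lemma handles the
  -- squares without assuming `g ∈ L²`.
  calc ∫⁻ x, ENNReal.ofReal ((g x - ∫ y, g y ∂(gibbsMeasure φ)) ^ 2) ∂(gibbsMeasure φ)
      = ∫⁻ x, liminf (fun k => ENNReal.ofReal ((G k x - ∫ y, G k y ∂(gibbsMeasure φ)) ^ 2)) atTop
          ∂(gibbsMeasure φ) := lintegral_congr fun x => (hlim x).liminf_eq.symm
    _ ≤ liminf (fun k => ∫⁻ x, ENNReal.ofReal ((G k x - ∫ y, G k y ∂(gibbsMeasure φ)) ^ 2)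
          ∂(gibbsMeasure φ)) atTop := lintegral_liminf_le fun k =>
        (((hG k).continuous.measurable.sub_const _).pow_const 2).ennreal_ofReal
    _ ≤ liminf (fun _ : ℕ => ∫⁻ x, invQuadForm (hessian φ x) (gradient g x) ∂(gibbsMeasure φ))
          atTop := liminf_le_liminf (Eventually.of_forall hbd)
    _ = _ := liminf_const _
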